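/- Write points of $\mathbb R^3$ as $(X,z)$, $X\in\mathbb R^2$. All functions are real valued. Let $g>0$, $0<\delta<1$, $\varepsilon>0$, and let $I\subset\mathbb R$ be an open set of times. **Bathymetry.** $b\in C^\infty(\mathbb R^2)$, $0<b_{\min}\le b\le b_{\max}$, and $b=b_{\max}$ outside some ball. For $\zeta:\mathbb R^2\to\mathbb R$ put $\Omega(\zeta,b)=\{(X,z):-b(X)<z<\zeta(X)\}$. **DN operator.** $\mathcal G(b)f=\partial_z\Phi|_{z=0}$, where $\Phi\in H^1(\Omega(0,b))$, $C^2$ up to the boundary, solves $\Delta_{X,z}\Phi=0$ in $\Omega(0,b)$, $\Phi|_{z=0}=f$, $\partial_\nu\Phi=0$ on $z=-b(X)$. **Background.** $\bar{\mathbf U}(t,X,z)=(\bar{\mathbf U}_h,\bar W)$ is smooth and $\bar\eta(t,X)$ is $C^1$ with $\bar\eta>-b$. For $t\in I$ and $-b\le z\le\max(0,\bar\eta)$ the current satisfies $\nabla_{X,z}\cdot\bar{\mathbf U}=0$; moreover $\nu\cdot\bar{\mathbf U}=0$ on $z=-b$, and $\partial_t\bar\eta+\bar{\mathbf U}_h\cdot\nabla_X\bar\eta=\bar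 W$ on $z=\bar\eta$. It is slowly varying: on the same region all spatial derivatives of order $k\ge 0$ satisfy $|D^k\bar{\mathbf U}|\le K_k\delta^{k}$, and $|\bar\eta|,|\partial_t\bar\eta|,|\nabla_X\bar\eta|\le A\delta$. Write $\bar U(t,X)=\bar{\mathbf U}_h(t,X,0)$ and $\bar W_0(t,X)=\bar W(t,X,0)$. **Waves.** For $t\in I$ the functions $\eta,\varphi$ solve $$\partial_t\eta+\nabla_X\cdot(\bar U\eta)=\mathcal G(b)\varphi,\qquad \partial_t\varphi+\bar U\cdot\nabla_X\varphi=-g\eta ,$$ $\phi(t,\cdot)$ is the potential in $\Omega(0,b)$ with surface value $\varphi(t,\cdot)$ (that is, the solution $\Phi$ above for $f=\varphi(t,\cdot)$), and $\mathbf u=\nabla_{X,z}\phi$. Sufficient smoothness and decay is assumed: $\eta$ is $C^1$ and $\phi$ is $C^3$ in space-time up to the boundary, and, locally uniformly in $t\in I$, $\eta$ and its first derivatives at $(t,X)$, and $\phi$ and its derivatives up to order three at $(t,X,z)$ for all $-b(X)\le z\le 0$, are bounded by some $h(X)$ with $h\in L^2(\mathbb R^2)$. The waves are of size $\varepsilon$: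 $\int_{\mathbb R^2}|\mathbf u(t,X,0)|^2\,dX\le (M\varepsilon)^2$ for $t\in I$. **Claim.** Let $\mathcal E=\tfrac12\left(g\,\eta^2+\varphi\,\mathcal G(b)\varphi\right)$, let $S(\bar{\mathbf U})=\tfrac12\left(\nabla_{X,z}\bar{\mathbf U}+(\nabla_{X,z}\bar{\mathbf U})^\top\right)$, and let $\mathcal P=-\mathbf u\cdot S(\bar{\mathbf U})\mathbf u$. Then, for every $t\in I$, all integrals below converge absolutely, $\int_{\mathbb R^2}\mathcal E\,dX$ is differentiable at $t$, and $$\frac{d}{dt}\int_{\mathbb R^2}\mathcal E\,dX=-\int_{\mathbb R^2}(\nabla_X\cdot\bar U)\,\tfrac12 g\,\eta^2\,dX+\int_{\Omega(0,b)}\mathcal P\,dX\,dz+r(t),\qquad |r(t)|\le C\varepsilon^2\delta ,$$ where $C$ depends only on $(K_k)_{k\ge0}$, $A$ and $M$. More precisely, $$r(t)=\tfrac12\int_{\mathbb R^2}\bar W_0\left((\mathcal G(b)\varphi)^2-|\nabla_X\varphi|^2\right)dX .$$ -/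

import Mathlib

open MeasureTheory Filter Topology Set
open scoped ContDiff Matrix

noncomputable section

/-- The horizontal plane with its Euclidean norm; its points are written `X`. -/
abbrev Plane : Type := EuclideanSpace ℝ (Fin 2)

/-- Points `(X, z)`, and vectors `(horizontal part, vertical part)`, of three-dimensional space. -/
abbrev Space : Type := Plane × ℝ

/-- The three coordinate directions `x₁, x₂, z`. -/
def coordDir : Fin 3 → Space :=
  ![(EuclideanSpace.single 0 1, 0), (EuclideanSpace.single 1 1, 0), (0, 1)]

/-- The three Cartesian components of a vector. -/
def cart (v : Space) : Fin 3 → ℝ := ![v.1 0, v.1 1, v.2]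

/-- The domain `Ω(η, b)` between the bottom `z = -b(X)` and the surface `z = η(X)`. -/
def fluidDomain (η b : Plane → ℝ) : Set Space := {p | -b p.1 < p.2 ∧ p.2 < η p.1}

/-- Divergence of a planar vector field. -/
def planeDiv (F : Plane → Plane) (X : Plane) : ℝ :=
  ∑ i : Fin 2, (fderiv ℝ F X (EuclideanSpace.single i 1)) i

/-- Divergence of a vector field in space. -/
def spaceDiv (F : Space → Space) (p : Space) : ℝ :=
  ∑ i : Fin 3, cart (fderiv ℝ F p (coordDir i)) i

/-- Gradient of a scalar function in space, in Cartesian components. -/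
def spaceGrad (Φ : Space → ℝ) (p : Space) : Fin 3 → ℝ := fun i => fderiv ℝ Φ p (coordDir i)

/-- Laplacian of a scalar function in space. -/
def spaceLaplacian (Φ : Space → ℝ) (p : Space) : ℝ :=
  ∑ i : Fin 3, fderiv ℝ (fun q => fderiv ℝ Φ q (coordDir i)) p (coordDir i)

/-- The downward normal `(-∇b, -1)` at the bottom point `(X, -b(X))`. It is not normalised, as it
only enters homogeneous conditions. -/
def bottomNormal (b : Plane → ℝ) (X : Plane) : Space := (-gradient b X, -1)

/-- The strain tensor `S(U) = (∇U + (∇U)ᵀ) / 2`. -/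
def strain (U : Space → Space) (p : Space) : Matrix (Fin 3) (Fin 3) ℝ :=
  let J : Matrix (Fin 3) (Fin 3) ℝ := Matrix.of fun i j => cart (fderiv ℝ U p (coordDir j)) i
  (1 / 2 : ℝ) • (J + Jᵀ)

/-- The production term `-u · S(U) u`. -/
def production (U : Space → Space) (u : Space → Fin 3 → ℝ) (p : Space) : ℝ :=
  -(u p ⬝ᵥ (strain U p *ᵥ u p))

/-- `Φ` is the potential in `Ω(0, b)` with surface value `f`: harmonic, equal to `f` at `z = 0`, with
vanishing normal derivative at the bottom, `C²` up to the boundary (in the sense that it is the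
restriction of a `C²` function on the whole space), and in `H¹(Ω(0, b))`, which makes it unique. -/
structure IsPotential (b f : Plane → ℝ) (Φ : Space → ℝ) : Prop where
  contDiff : ContDiff ℝ 2 Φ
  harmonic : ∀ p ∈ fluidDomain 0 b, spaceLaplacian Φ p = 0
  surface : ∀ X, Φ (X, 0) = f X
  bottom : ∀ X, fderiv ℝ Φ (X, -b X) (bottomNormal b X) = 0
  memLp : MemLp Φ 2 (volume.restrict (fluidDomain 0 b))
  memLp_fderiv : MemLp (fderiv ℝ Φ) 2 (volume.restrict (fluidDomain 0 b))

open Classical in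
/-- The Dirichlet-to-Neumann operator `𝒢(b) f = ∂_z Φ` at `z = 0`, where `Φ` is the potential with
surface value `f`. (It is `0` by convention if there is no such potential.) -/
def dirichletNeumann (b f : Plane → ℝ) : Plane → ℝ :=
  if h : ∃ Φ, IsPotential b f Φ then fun X => fderiv ℝ h.choose (X, 0) (0, 1) else 0

/-- The depth is smooth, bounded between positive constants, and constant far away. -/
structure IsBathymetry (b : Plane → ℝ) : Prop where
  contDiff : ContDiff ℝ ∞ b
  exists_bounds : ∃ bmin bmax R : ℝ, 0 < bmin ∧ (∀ X, bmin ≤ b X ∧ b X ≤ bmax) ∧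
    ∀ X, R < ‖X‖ → b X = bmax

/-- A slowly varying background current `U` with surface elevation `ζ`, over the depth `b`, at the
times in `I`. The current is given, together with its extension up to the mean level `z = 0`, for
`-b ≤ z ≤ max 0 ζ`. The constants `K` and `A` are those in the orders of magnitude in `δ`:
`|D^α U| ≤ K |α| δ ^ |α|` for spatial derivatives, and `ζ, ∂ₜζ, ∇ζ` are at most `A δ`. -/
structure IsBackground (I : Set ℝ) (b : Plane → ℝ) (δ : ℝ) (K : ℕ → ℝ) (A : ℝ)
    (U : ℝ → Space → Space) (ζ : ℝ → Plane → ℝ) : Prop where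
  contDiff : ContDiffOn ℝ ∞ (fun q : ℝ × Space => U q.1 q.2) (I ×ˢ univ)
  contDiff_elevation : ContDiffOn ℝ 1 (fun q : ℝ × Plane => ζ q.1 q.2) (I ×ˢ univ)
  depth_pos : ∀ t ∈ I, ∀ X, -b X < ζ t X
  incompressible : ∀ t ∈ I, ∀ X z, -b X ≤ z → z ≤ max 0 (ζ t X) → spaceDiv (U t) (X, z) = 0
  impermeable : ∀ t ∈ I, ∀ X, cart (U t (X, -b X)) ⬝ᵥ cart (bottomNormal b X) = 0
  kinematic : ∀ t ∈ I, ∀ X, deriv (fun s => ζ s X) t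
    + fderiv ℝ (ζ t) X (U t (X, ζ t X)).1 = (U t (X, ζ t X)).2
  slow : ∀ t ∈ I, ∀ X z, -b X ≤ z → z ≤ max 0 (ζ t X) →
    ∀ k : ℕ, ‖iteratedFDeriv ℝ k (U t) (X, z)‖ ≤ K k * δ ^ k
  elevation_le : ∀ t ∈ I, ∀ X, |ζ t X| ≤ A * δ
  deriv_elevation_le : ∀ t ∈ I, ∀ X, |deriv (fun s => ζ s X) t| ≤ A * δ
  grad_elevation_le : ∀ t ∈ I, ∀ X, ‖fderiv ℝ (ζ t) X‖ ≤ A * δ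

/-- The surface current: the horizontal part of the background current at `z = 0`. -/
def surfaceCurrent (U : ℝ → Space → Space) (t : ℝ) (X : Plane) : Plane := (U t (X, 0)).1

/-- `(η, φ)` solves, at the times in `I`, the linear wave system
`∂ₜη + ∇ · (U η) = 𝒢(b) φ`, `∂ₜφ + U · ∇φ = -g η`, where `U` is the surface current. -/
structure IsWave (I : Set ℝ) (g : ℝ) (b : Plane → ℝ) (U : ℝ → Space → Space)
    (η φ : ℝ → Plane → ℝ) : Prop where
  elevation_eq : ∀ t ∈ I, ∀ X, deriv (fun s => η s X) t
    + planeDiv (fun Y => η t Y • surfaceCurrent U t Y) X = dirichletNeumann b (φ t) X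
  potential_eq : ∀ t ∈ I, ∀ X, deriv (fun s => φ s X) t
    + fderiv ℝ (φ t) X (surfaceCurrent U t X) = -g * η t X

/-- Sufficient smoothness and decay at infinity of the elevation `η` and of the bulk potential `Φ`:
`η` is `C¹` and `Φ` is `C³` in space-time, up to the boundary, and, locally uniformly in time, all
these derivatives are dominated at `X` (in the case of `Φ`, on the whole vertical fluid column) by a
square integrable function of `X`. -/
structure IsSmoothDecaying (I : Set ℝ) (b : Plane → ℝ) (η : ℝ → Plane → ℝ) (Φ : ℝ → Space → ℝ) :
    Prop where
  contDiff_elevation : ContDiffOn ℝ 1 (fun q : ℝ × Plane => η q.1 q.2) (I ×ˢ univ)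
  contDiff_potential : ContDiffOn ℝ 3 (fun q : ℝ × Space => Φ q.1 q.2) (I ×ˢ univ)
  decay : ∀ t₀ ∈ I, ∃ h : Plane → ℝ, MemLp h 2 volume ∧ ∀ᶠ t in 𝓝 t₀, ∀ X,
    (∀ k ≤ 1, ‖iteratedFDeriv ℝ k (fun q : ℝ × Plane => η q.1 q.2) (t, X)‖ ≤ h X) ∧
    (∀ z, -b X ≤ z → z ≤ 0 →
      ∀ k ≤ 3, ‖iteratedFDeriv ℝ k (fun q : ℝ × Space => Φ q.1 q.2) (t, (X, z))‖ ≤ h X)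

/-- The energy density `(g η² + φ 𝒢(b) φ) / 2`. -/
def energyDensity (g : ℝ) (b η φ : Plane → ℝ) (X : Plane) : ℝ :=
  1 / 2 * (g * (η X) ^ 2 + φ X * dirichletNeumann b φ X)

end

/-! The operator `𝒢` is symmetric, because by Green's identity both `∫ f₁ 𝒢f₂` and `∫ f₂ 𝒢f₁` equal
`∫ ∇Φ·∇Ψ` over the fluid (`green`). Hence the kinetic energy `½∫ φ𝒢φ` has time derivative `∫ ∂ₜφ
𝒢φ`, and the energy changes at the rate `∫ gη ∂ₜη + ∂ₜφ 𝒢φ` (`hasDerivAt_energy`). When the wave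
equations are inserted, the exchange terms `± gη 𝒢φ` cancel. What remains is `-g ∫ η ∇·(ηŪ) - ∫
(Ū·∇φ) 𝒢φ`.

The first term is `-½g ∫ (∇·Ū) η²`, since `2η ∇·(ηŪ) - (∇·Ū) η²` is the divergence of `η² Ū`
(`integral_mul_planeDiv_smul`).

For the second, let `V` be the full current and take the field `F = (V·∇Φ) ∇Φ - ½|∇Φ|² V`. As `Φ` is
harmonic and `V` divergence free, the second derivatives of `Φ` cancel and `∇·F = ∇Φ·S(V)∇Φ = -𝒫`
(`spaceDiv_stress`). The flux of `F` vanishes at the bottom, where `V` and `∇Φ` are both tangential.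
At `z = 0` it is `(Ū·∇φ) 𝒢φ + ½ W̄₀ ((𝒢φ)² - |∇φ|²)`. The divergence theorem (`integral_production`)
therefore gives the production and the exact remainder `r`.

The remainder is small because `W̄₀ = O(δ)`: the kinematic condition gives this at the elevated
surface, and the mean value inequality carries it to `z = 0` (`IsBackground.abs_vertical_le`).
Moreover `|(𝒢φ)² - |∇φ|²| ≤ |u|²` at the surface, whose integral is at most `(Mε)²`. -/

/-! ### Column integrals and divergences in the plane -/

theorem hasFDerivAt_intervalIntegral_of_contDiff {E F : Type*} [NormedAddCommGroup E]
    [NormedSpace ℝ E] [FiniteDimensional ℝ E] [NormedAddCommGroup F] [NormedSpace ℝ F]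
    {k : E × ℝ → F} (hk : ContDiff ℝ 1 k) (a b : ℝ) (x : E) :
    HasFDerivAt (fun y => ∫ s in a..b, k (y, s))
      (∫ s in a..b, (fderiv ℝ k (x, s)).comp (ContinuousLinearMap.inl ℝ E ℝ)) x := by
  have hk' : Continuous (fderiv ℝ k) := hk.continuous_fderiv one_ne_zero
  have hcont : Continuous fun q : E × ℝ =>
      (fderiv ℝ k q).comp (ContinuousLinearMap.inl ℝ E ℝ) := by fun_prop
  obtain ⟨C, hC⟩ := ((isCompact_closedBall x 1).prod
    (isCompact_uIcc (a := a) (b := b))).exists_bound_of_continuousOn hcont.continuousOn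
  refine intervalIntegral.hasFDerivAt_integral_of_dominated_of_fderiv_le
    (F' := fun y s => (fderiv ℝ k (y, s)).comp (ContinuousLinearMap.inl ℝ E ℝ))
    (bound := fun _ => C) (Metric.closedBall_mem_nhds x one_pos) ?_ ?_ ?_ ?_ ?_ ?_
  · refine Eventually.of_forall fun y => Continuous.aestronglyMeasurable ?_
    exact hk.continuous.comp (by fun_prop)
  · exact (hk.continuous.comp (by fun_prop : Continuous fun s : ℝ => (x, s))).intervalIntegrable _ _
  · exact (hcont.comp (by fun_prop : Continuous fun s : ℝ => (x, s))).aestronglyMeasurable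
  · exact Eventually.of_forall fun s hs y hy => hC (y, s) ⟨hy, uIoc_subset_uIcc hs⟩
  · exact intervalIntegrable_const
  · refine Eventually.of_forall fun s _ y _ => ?_
    exact ((hk.differentiable one_ne_zero (y, s)).hasFDerivAt).comp y (hasFDerivAt_prodMk_left y s)

/-- Leibniz rule for integration over the vertical column between `-b X` and `0`. -/
theorem hasFDerivAt_columnIntegral {F : Type*} [NormedAddCommGroup F] [NormedSpace ℝ F]
    [CompleteSpace F] {b : Plane → ℝ} (hb : ContDiff ℝ 1 b) {f : Space → F}
    (hf : ContDiff ℝ 1 f) (X : Plane) :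
    HasFDerivAt (fun Y => ∫ z in (-b Y)..0, f (Y, z))
      ((∫ z in (-b X)..0, (fderiv ℝ f (X, z)).comp (ContinuousLinearMap.inl ℝ Plane ℝ))
        + (fderiv ℝ b X).smulRight (f (X, -b X))) X := by
  -- The substitution `z = -c s` moves the integral to the fixed interval `[0, 1]`, with the depth
  -- `c` as an independent parameter.
  let k : (Plane × ℝ) × ℝ → F := fun q => q.1.2 • f (q.1.1, -(q.1.2 * q.2))
  have hk : ContDiff ℝ 1 k := by
    refine ContDiff.smul (by fun_prop) (hf.comp (by fun_prop))
  have hsub : ∀ q : Plane × ℝ, ∫ s in (0 : ℝ)..1, k (q, s) = ∫ z in (-q.2)..0, f (q.1, z) := by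
    intro q
    simp only [k, intervalIntegral.integral_smul]
    have := intervalIntegral.smul_integral_comp_mul_left (a := 0) (b := 1)
      (fun s => f (q.1, -s)) q.2
    rw [this, intervalIntegral.integral_comp_neg (fun s => f (q.1, s))]
    simp
  set c := b X with hc
  have hD := hasFDerivAt_intervalIntegral_of_contDiff hk 0 1 (X, c)
  set L := ∫ s in (0 : ℝ)..1, (fderiv ℝ k ((X, c), s)).comp
    (ContinuousLinearMap.inl ℝ (Plane × ℝ) ℝ)
  simp only [hsub] at hD
  have hcf : Continuous (fderiv ℝ f) := hf.continuous_fderiv one_ne_zero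
  -- The joint derivative `L` in position and depth is identified through uniqueness of derivatives:
  -- on horizontal directions by keeping the depth fixed, on the depth direction by the fundamental
  -- theorem of calculus.
  have h1 : ∀ v : Plane, L (v, 0) = ∫ z in (-c)..0, fderiv ℝ f (X, z) (v, 0) := by
    intro v
    have e1 : HasFDerivAt (fun Y : Plane => ∫ s in (0 : ℝ)..1, k ((Y, c), s))
        (L.comp (ContinuousLinearMap.inl ℝ Plane ℝ)) X := by
      exact HasFDerivAt.comp (f := fun Y : Plane => (Y, c)) X
        (hasFDerivAt_intervalIntegral_of_contDiff hk 0 1 (X, c)) (hasFDerivAt_prodMk_left X c)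
    have hm : ContDiff ℝ 1 fun q : Plane × ℝ => k ((q.1, c), q.2) :=
      hk.comp (by fun_prop)
    have e2 := hasFDerivAt_intervalIntegral_of_contDiff hm 0 1 X
    have e3 := congrArg (fun T => T v) (e1.unique e2)
    simp only [ContinuousLinearMap.comp_apply, ContinuousLinearMap.inl_apply] at e3
    rw [e3, ContinuousLinearMap.intervalIntegral_apply]
    · have hpt : ∀ s : ℝ, (fderiv ℝ (fun q : Plane × ℝ => k ((q.1, c), q.2)) (X, s)).comp
          (ContinuousLinearMap.inl ℝ Plane ℝ) v = c • fderiv ℝ f (X, -(c * s)) (v, 0) := by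
        intro s
        have a1 : HasFDerivAt (fun Y : Plane => k ((Y, c), s))
            ((fderiv ℝ (fun q : Plane × ℝ => k ((q.1, c), q.2)) (X, s)).comp
              (ContinuousLinearMap.inl ℝ Plane ℝ)) X :=
          HasFDerivAt.comp (f := fun Y : Plane => (Y, s)) X
            (hm.differentiable one_ne_zero (X, s)).hasFDerivAt (hasFDerivAt_prodMk_left X s)
        have a2 : HasFDerivAt (fun Y : Plane => k ((Y, c), s))
            (c • (fderiv ℝ f (X, -(c * s))).comp (ContinuousLinearMap.inl ℝ Plane ℝ)) X :=
          (HasFDerivAt.comp (f := fun Y : Plane => (Y, -(c * s))) X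
            (hf.differentiable one_ne_zero (X, -(c * s))).hasFDerivAt
            (hasFDerivAt_prodMk_left X (-(c * s)))).const_smul c
        rw [a1.unique a2]
        simp
      simp only [hpt]
      rw [intervalIntegral.integral_smul]
      have := intervalIntegral.smul_integral_comp_mul_left (a := 0) (b := 1)
        (fun s => fderiv ℝ f (X, -s) (v, 0)) c
      rw [this, intervalIntegral.integral_comp_neg (fun s => fderiv ℝ f (X, s) (v, 0))]
      simp
    · refine Continuous.intervalIntegrable ?_ _ _
      have := hm.continuous_fderiv one_ne_zero
      fun_prop
  have h2 : L (0, 1) = f (X, -c) := by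
    have hfX : Continuous fun z : ℝ => f (X, z) := hf.continuous.comp (by fun_prop)
    have e1 : HasDerivAt (fun d : ℝ => ∫ z in (-d)..0, f (X, z)) (L (0, 1)) c := by
      have h := hD.comp_hasDerivAt c ((hasDerivAt_const c X).prodMk (hasDerivAt_id c))
      exact h
    have e2 : HasDerivAt (fun d : ℝ => ∫ z in (-d)..0, f (X, z)) (f (X, -c)) c := by
      have := (intervalIntegral.integral_hasDerivAt_left (hfX.intervalIntegrable (-c) 0)
        (hfX.stronglyMeasurableAtFilter _ _) hfX.continuousAt)
      have h := HasDerivAt.scomp c this (hasDerivAt_neg c)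
      simpa [Function.comp_def] using h
    exact e1.unique e2
  have hb' : HasFDerivAt b (fderiv ℝ b X) X := (hb.differentiable one_ne_zero X).hasFDerivAt
  have key := hD.comp X ((hasFDerivAt_id X).prodMk hb')
  refine key.congr_fderiv (ContinuousLinearMap.ext fun v => ?_)
  have hv : ((ContinuousLinearMap.id ℝ Plane).prod (fderiv ℝ b X)) v
      = (v, 0) + (fderiv ℝ b X v) • ((0, 1) : Plane × ℝ) := by
    simp
  rw [ContinuousLinearMap.comp_apply, hv, map_add, map_smul, h1, h2,
    add_apply, ContinuousLinearMap.intervalIntegral_apply]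
  · simp
  · exact Continuous.intervalIntegrable (by fun_prop) _ _

/-- A vector field in the plane that is integrable together with its divergence has zero total
divergence. -/
theorem integral_planeDiv_eq_zero {G : Plane → Plane} (hG : ContDiff ℝ 1 G)
    (hGi : Integrable G) (hdiv : Integrable (planeDiv G)) : ∫ X, planeDiv G X = 0 := by
  let f : ContDiffBump (0 : Plane) := ⟨1, 2, one_pos, one_lt_two⟩
  have hfC : ContDiff ℝ 1 f := f.contDiff
  have hf'c : HasCompactSupport (fderiv ℝ f) := f.hasCompactSupport.fderiv ℝ
  obtain ⟨C, hC⟩ := hf'c.exists_bound_of_continuous (hfC.continuous_fderiv one_ne_zero)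
  have hC0 : 0 ≤ C := (norm_nonneg _).trans (hC 0)
  have hG' : Continuous (fderiv ℝ G) := hG.continuous_fderiv one_ne_zero
  have hdc : Continuous (planeDiv G) := by
    unfold planeDiv
    fun_prop
  -- Cutoffs at scale `n + 1` have gradients of size `1 / (n + 1)`, so integrability of `G` alone
  -- kills the term left by integration by parts; no pointwise decay is needed.
  let χ : ℕ → Plane → ℝ := fun n X => f ((n + 1 : ℝ)⁻¹ • X)
  have hχ : ∀ n, ContDiff ℝ 1 (χ n) := fun n => hfC.comp (by fun_prop)
  have hχs : ∀ n, HasCompactSupport (χ n) := fun n =>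
    f.hasCompactSupport.comp_smul (by positivity)
  have hχ' : ∀ n X, ‖fderiv ℝ (χ n) X‖ ≤ (n + 1 : ℝ)⁻¹ * C := by
    intro n X
    have h : HasFDerivAt (χ n) ((fderiv ℝ f ((n + 1 : ℝ)⁻¹ • X)).comp
        ((n + 1 : ℝ)⁻¹ • ContinuousLinearMap.id ℝ Plane)) X :=
      ((hfC.differentiable one_ne_zero _).hasFDerivAt).comp X
        ((hasFDerivAt_id X).const_smul ((n + 1 : ℝ)⁻¹))
    rw [h.fderiv, ContinuousLinearMap.comp_smul, ContinuousLinearMap.comp_id, norm_smul,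
      Real.norm_of_nonneg (by positivity)]
    exact mul_le_mul_of_nonneg_left (hC _) (by positivity)
  have hcoord : ∀ (i : Fin 2) X, fderiv ℝ (fun Y => G Y i) X (EuclideanSpace.single i 1)
      = (fderiv ℝ G X (EuclideanSpace.single i 1)) i := by
    intro i X
    have h := (EuclideanSpace.proj (𝕜 := ℝ) i).hasFDerivAt.comp X
      (hG.differentiable one_ne_zero X).hasFDerivAt
    have h2 : HasFDerivAt (fun Y => G Y i) ((EuclideanSpace.proj (𝕜 := ℝ) i).comp (fderiv ℝ G X)) X :=
      h
    rw [h2.fderiv]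
    rfl
  have hGc : ∀ i : Fin 2, Continuous fun Y => G Y i := fun i =>
    (EuclideanSpace.proj (𝕜 := ℝ) i).continuous.comp hG.continuous
  have hparts : ∀ n, ∫ X, χ n X * planeDiv G X
      = - ∑ i : Fin 2, ∫ X, fderiv ℝ (χ n) X (EuclideanSpace.single i 1) * G X i := by
    intro n
    have hχc : Continuous (fderiv ℝ (χ n)) := (hχ n).continuous_fderiv one_ne_zero
    have hχcs : HasCompactSupport (fderiv ℝ (χ n)) := (hχs n).fderiv ℝ
    have hi : ∀ i : Fin 2, Integrable
        fun X => χ n X * fderiv ℝ (fun Y => G Y i) X (EuclideanSpace.single i 1) := by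
      intro i
      refine Continuous.integrable_of_hasCompactSupport ?_ (hχs n).mul_right
      simp only [hcoord]
      have := (hχ n).continuous
      fun_prop
    have h1 : ∀ X, χ n X * planeDiv G X = ∑ i : Fin 2,
        χ n X * fderiv ℝ (fun Y => G Y i) X (EuclideanSpace.single i 1) := by
      intro X
      simp only [hcoord, planeDiv, Finset.mul_sum]
    simp only [h1]
    rw [integral_finsetSum _ fun i _ => hi i, ← Finset.sum_neg_distrib]
    refine Finset.sum_congr rfl fun i _ => ?_
    refine integral_mul_fderiv_eq_neg_fderiv_mul_of_integrable ?_ (hi i) ?_ ?_ ?_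
    · refine Continuous.integrable_of_hasCompactSupport ?_ ?_
      · have := hGc i
        fun_prop
      · exact HasCompactSupport.mul_right (hχcs.comp_left (g := fun L : Plane →L[ℝ] ℝ =>
          L (EuclideanSpace.single i 1)) rfl)
    · exact Continuous.integrable_of_hasCompactSupport ((hχ n).continuous.mul (hGc i))
        (hχs n).mul_right
    · exact fun X _ => (hχ n).differentiable one_ne_zero X
    · intro X _
      exact ((EuclideanSpace.proj (𝕜 := ℝ) i).differentiableAt).comp X
        (hG.differentiable one_ne_zero X)
  have hlim1 : Tendsto (fun n => ∫ X, χ n X * planeDiv G X) atTop (𝓝 (∫ X, planeDiv G X)) := by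
    refine tendsto_integral_of_dominated_convergence (fun X => ‖planeDiv G X‖) ?_ hdiv.norm ?_ ?_
    · exact fun n => ((hχ n).continuous.mul hdc).aestronglyMeasurable
    · intro n
      refine Eventually.of_forall fun X => ?_
      rw [norm_mul, Real.norm_of_nonneg (f.nonneg)]
      exact mul_le_of_le_one_left (norm_nonneg _) f.le_one
    · refine Eventually.of_forall fun X => ?_
      have hz : Tendsto (fun n : ℕ => (n + 1 : ℝ)⁻¹ • X) atTop (𝓝 0) := by
        have := (tendsto_one_div_add_atTop_nhds_zero_nat (𝕜 := ℝ)).smul_const X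
        simpa using this
      have h1 : ∀ᶠ n : ℕ in atTop, χ n X = 1 := hz.eventually f.eventuallyEq_one
      refine tendsto_const_nhds.congr' ?_
      filter_upwards [h1] with n hn
      rw [hn, one_mul]
  have hlim2 : Tendsto (fun n => ∫ X, χ n X * planeDiv G X) atTop (𝓝 0) := by
    refine squeeze_zero_norm (a := fun n : ℕ => 2 * ((n + 1 : ℝ)⁻¹ * C * ∫ X, ‖G X‖)) ?_ ?_
    · intro n
      rw [hparts n, norm_neg]
      refine (norm_sum_le _ _).trans ?_
      have : ∀ i : Fin 2, ‖∫ X, fderiv ℝ (χ n) X (EuclideanSpace.single i 1) * G X i‖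
          ≤ (n + 1 : ℝ)⁻¹ * C * ∫ X, ‖G X‖ := by
        intro i
        rw [← integral_const_mul]
        refine norm_integral_le_of_norm_le (hGi.norm.const_mul _) (Eventually.of_forall fun X => ?_)
        rw [norm_mul]
        refine mul_le_mul ?_ (PiLp.norm_apply_le (G X) i) (norm_nonneg _) (by positivity)
        refine (ContinuousLinearMap.le_opNorm _ _).trans ?_
        simpa using hχ' n X
      refine (Finset.sum_le_sum fun i _ => this i).trans ?_
      simp
    · have := (tendsto_one_div_add_atTop_nhds_zero_nat (𝕜 := ℝ)).mul_const (2 * C * ∫ X, ‖G X‖)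
      simp only [zero_mul] at this
      refine this.congr fun n => ?_
      rw [one_div]
      ring
  exact tendsto_nhds_unique hlim1 hlim2

/-! ### Fubini and the divergence theorem in the fluid domain -/

theorem isOpen_fluidDomain_zero {b : Plane → ℝ} (hb : Continuous b) :
    IsOpen (fluidDomain 0 b) :=
  (isOpen_lt (by fun_prop : Continuous fun p : Space => -b p.1) continuous_snd).inter
    (isOpen_lt continuous_snd continuous_const)

section Fubini

variable {E : Type*} [NormedAddCommGroup E] [NormedSpace ℝ E] {b : Plane → ℝ} {f : Space → E}

theorem integral_indicator_fluidDomain_column (hpos : ∀ X, 0 < b X) (X : Plane) :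
    ∫ z, (fluidDomain 0 b).indicator f (X, z) = ∫ z in (-b X)..0, f (X, z) := by
  rw [intervalIntegral.integral_of_le (by linarith [hpos X]), integral_Ioc_eq_integral_Ioo,
    ← integral_indicator measurableSet_Ioo]
  rfl

theorem integrable_columnIntegral (hb : Continuous b) (hpos : ∀ X, 0 < b X)
    (hf : IntegrableOn f (fluidDomain 0 b)) :
    Integrable fun X => ∫ z in (-b X)..0, f (X, z) := by
  have h := (hf.integrable_indicator (isOpen_fluidDomain_zero hb).measurableSet)
  rw [Measure.volume_eq_prod] at h
  simpa only [integral_indicator_fluidDomain_column hpos] using h.integral_prod_left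

theorem setIntegral_fluidDomain_eq (hb : Continuous b) (hpos : ∀ X, 0 < b X)
    (hf : IntegrableOn f (fluidDomain 0 b)) :
    ∫ p in fluidDomain 0 b, f p = ∫ X, ∫ z in (-b X)..0, f (X, z) := by
  have h := (hf.integrable_indicator (isOpen_fluidDomain_zero hb).measurableSet)
  rw [← integral_indicator (isOpen_fluidDomain_zero hb).measurableSet]
  rw [Measure.volume_eq_prod] at h ⊢
  rw [integral_prod _ h]
  simp only [integral_indicator_fluidDomain_column hpos]

end Fubini

theorem continuousLinearMap_apply_eq_sum_cart (L : Space →L[ℝ] ℝ) (v : Space) :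
    L v = ∑ i, cart v i * L (coordDir i) := by
  have hv : v = ∑ i, cart v i • coordDir i := by
    simp only [Fin.sum_univ_three, cart, coordDir]
    ext i
    · fin_cases i <;> simp
    · simp
  conv_lhs => rw [hv]
  simp [map_sum]

theorem fderiv_apply_eq_inner_gradient {b : Plane → ℝ} (X v : Plane) :
    fderiv ℝ b X v = gradient b X 0 * v 0 + gradient b X 1 * v 1 := by
  rw [← InnerProductSpace.toDual_symm_apply (𝕜 := ℝ) (x := v) (y := fderiv ℝ b X),
    PiLp.inner_apply]
  simp [gradient, mul_comm]

theorem cart_dotProduct_bottomNormal {b : Plane → ℝ} (X : Plane) (v : Space) :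
    cart v ⬝ᵥ cart (bottomNormal b X) = -fderiv ℝ b X v.1 - v.2 := by
  rw [fderiv_apply_eq_inner_gradient]
  simp [dotProduct, Fin.sum_univ_three, cart, bottomNormal]
  ring

theorem spaceDiv_eq (F : Space → Space) (p : Space) :
    spaceDiv F p = ∑ i : Fin 2, (fderiv ℝ F p (EuclideanSpace.single i 1, 0)).1 i
      + (fderiv ℝ F p (0, 1)).2 := by
  simp [spaceDiv, Fin.sum_univ_three, cart, coordDir]

/-- The divergence theorem in the fluid domain. -/
theorem integral_spaceDiv {b : Plane → ℝ} (hb : ContDiff ℝ 1 b) (hpos : ∀ X, 0 < b X)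
    {F : Space → Space} (hF : ContDiff ℝ 1 F) (hFi : IntegrableOn F (fluidDomain 0 b))
    (hdiv : IntegrableOn (spaceDiv F) (fluidDomain 0 b))
    (hflux : Integrable fun X =>
      (F (X, 0)).2 + cart (F (X, -b X)) ⬝ᵥ cart (bottomNormal b X)) :
    ∫ p in fluidDomain 0 b, spaceDiv F p
      = ∫ X, ((F (X, 0)).2 + cart (F (X, -b X)) ⬝ᵥ cart (bottomNormal b X)) := by
  have hF' : Continuous (fderiv ℝ F) := hF.continuous_fderiv one_ne_zero
  have hb' : Continuous (fderiv ℝ b) := hb.continuous_fderiv one_ne_zero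
  have hFc := hF.continuous
  have hbc := hb.continuous
  have hF1 : ContDiff ℝ 1 fun p => (F p).1 := contDiff_fst.comp hF
  have hF1' : Continuous (fderiv ℝ fun p => (F p).1) := hF1.continuous_fderiv one_ne_zero
  set G : Plane → Plane := fun X => ∫ z in (-b X)..0, (F (X, z)).1 with hGdef
  have hGd := fun X => hasFDerivAt_columnIntegral hb hF1 X
  have hG : ContDiff ℝ 1 G := by
    -- The divergence theorem is reduced to the plane: `G` is the column integral of the horizontal
    -- part, and its Leibniz derivative has to be continuous. The integral is reversed below so that
    -- the fixed endpoint `0` comes first.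
    refine contDiff_one_iff_hasFDerivAt.2 ⟨_, ?_, hGd⟩
    refine Continuous.add ?_ ?_
    · refine (intervalIntegral.continuous_parametric_intervalIntegral_of_continuous (a₀ := 0)
        (μ := volume) (f := fun X z => (fderiv ℝ (fun p => (F p).1) (X, z)).comp
          (ContinuousLinearMap.inl ℝ Plane ℝ)) ?_ hbc.neg).neg.congr
          fun X => (intervalIntegral.integral_symm _ _).symm
      simp only [Function.uncurry_def]
      fun_prop
    · have : Continuous fun X => (F (X, -b X)).1 := by fun_prop
      fun_prop
  have hGi : Integrable G := integrable_columnIntegral hbc hpos hFi.fst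
  -- The Leibniz boundary term `∇b · F_h` at `z = -b` combines with the endpoint values of `∫ ∂_z
  -- F_z` to give exactly the flux through the unnormalised bottom normal and the surface.
  have hdivG : ∀ X, planeDiv G X = (∫ z in (-b X)..0, spaceDiv F (X, z))
      - ((F (X, 0)).2 + cart (F (X, -b X)) ⬝ᵥ cart (bottomNormal b X)) := by
    intro X
    have hfst : ∀ p v, fderiv ℝ (fun q => (F q).1) p v = (fderiv ℝ F p v).1 := by
      intro p v
      rw [((hF.differentiable one_ne_zero p).hasFDerivAt.fst).fderiv]
      rfl
    have hint : ∀ v : Space, IntervalIntegrable (fun z => (fderiv ℝ F (X, z) v).1) volume (-b X) 0 :=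
      fun v => Continuous.intervalIntegrable (by fun_prop) _ _
    have hcol : ∀ i : Fin 2, (fderiv ℝ G X (EuclideanSpace.single i 1)) i
        = (∫ z in (-b X)..0, (fderiv ℝ F (X, z) (EuclideanSpace.single i 1, 0)).1 i)
          + fderiv ℝ b X (EuclideanSpace.single i 1) * (F (X, -b X)).1 i := by
      intro i
      rw [(hGd X).fderiv, add_apply, ContinuousLinearMap.intervalIntegral_apply]
      · simp only [ContinuousLinearMap.comp_apply, ContinuousLinearMap.inl_apply, hfst,
          ContinuousLinearMap.smulRight_apply, PiLp.add_apply, PiLp.smul_apply, smul_eq_mul]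
        congr 1
        exact ((EuclideanSpace.proj (𝕜 := ℝ) i).intervalIntegral_comp_comm
          (hint (EuclideanSpace.single i 1, 0))).symm
      · exact Continuous.intervalIntegrable (by fun_prop) _ _
    have hvert : ∫ z in (-b X)..0, (fderiv ℝ F (X, z) (0, 1)).2
        = (F (X, 0)).2 - (F (X, -b X)).2 := by
      refine intervalIntegral.integral_eq_sub_of_hasDerivAt
        (f := fun z => (F (X, z)).2) (fun z _ => ?_)
        (Continuous.intervalIntegrable (by fun_prop) _ _)
      have h := (hF.differentiable one_ne_zero (X, z)).hasFDerivAt.comp_hasDerivAt z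
        ((hasDerivAt_const z X).prodMk (hasDerivAt_id z))
      exact h.snd
    have hfd : fderiv ℝ b X (F (X, -b X)).1 = ∑ i : Fin 2,
        fderiv ℝ b X (EuclideanSpace.single i 1) * (F (X, -b X)).1 i := by
      simp [fderiv_apply_eq_inner_gradient, Fin.sum_univ_two]
    simp only [planeDiv, hcol, Finset.sum_add_distrib]
    rw [cart_dotProduct_bottomNormal, hfd]
    simp only [spaceDiv_eq]
    rw [intervalIntegral.integral_add, intervalIntegral.integral_finsetSum, hvert]
    · ring
    · exact fun i _ => Continuous.intervalIntegrable (by fun_prop) _ _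
    · exact Continuous.intervalIntegrable (by fun_prop) _ _
    · exact Continuous.intervalIntegrable (by fun_prop) _ _
  have hI := integrable_columnIntegral hbc hpos hdiv
  have hzero := integral_planeDiv_eq_zero hG hGi (by
    rw [show planeDiv G = _ from funext hdivG]
    exact hI.sub hflux)
  simp only [hdivG] at hzero
  rw [integral_sub hI hflux, sub_eq_zero] at hzero
  rw [setIntegral_fluidDomain_eq hbc hpos hdiv, hzero]

/-! ### Cartesian components -/

/-- The vector with given Cartesian components. -/
noncomputable def ofCart (u : Fin 3 → ℝ) : Space := ∑ i, u i • coordDir i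

/-- The Cartesian coordinate functions. -/
noncomputable def cartCoord : Fin 3 → Space →L[ℝ] ℝ :=
  ![(EuclideanSpace.proj 0).comp (ContinuousLinearMap.fst ℝ Plane ℝ),
    (EuclideanSpace.proj 1).comp (ContinuousLinearMap.fst ℝ Plane ℝ),
    ContinuousLinearMap.snd ℝ Plane ℝ]

theorem cart_eq_cartCoord (v : Space) (i : Fin 3) : cart v i = cartCoord i v := by
  fin_cases i <;> rfl

theorem cart_ofCart (u : Fin 3 → ℝ) : cart (ofCart u) = u := by
  ext i
  fin_cases i <;> simp [ofCart, cart, coordDir, Fin.sum_univ_three]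

theorem ofCart_snd (u : Fin 3 → ℝ) : (ofCart u).2 = u 2 := congrFun (cart_ofCart u) 2

theorem norm_coordDir_le (i : Fin 3) : ‖coordDir i‖ ≤ 1 := by
  fin_cases i <;> simp [coordDir, Prod.norm_def]

theorem abs_cart_le (v : Space) (i : Fin 3) : |cart v i| ≤ ‖v‖ := by
  fin_cases i
  · exact (PiLp.norm_apply_le v.1 0).trans (norm_fst_le v)
  · exact (PiLp.norm_apply_le v.1 1).trans (norm_fst_le v)
  · exact norm_snd_le v

theorem contDiff_cart {F : Space → Space} {n : WithTop ℕ∞} (hF : ContDiff ℝ n F) (i : Fin 3) :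
    ContDiff ℝ n fun p => cart (F p) i := by
  simp only [cart_eq_cartCoord]
  fun_prop

theorem fderiv_cart {F : Space → Space} {p : Space} (hF : DifferentiableAt ℝ F p) (i : Fin 3)
    (v : Space) : fderiv ℝ (fun q => cart (F q) i) p v = cart (fderiv ℝ F p v) i := by
  simp only [cart_eq_cartCoord]
  exact DFunLike.congr_fun ((cartCoord i).hasFDerivAt.comp p hF.hasFDerivAt).fderiv v

theorem contDiff_ofCart {u : Fin 3 → Space → ℝ} {n : WithTop ℕ∞} (hu : ∀ i, ContDiff ℝ n (u i)) :
    ContDiff ℝ n fun p => ofCart fun i => u i p := by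
  unfold ofCart
  fun_prop

theorem spaceDiv_ofCart {u : Fin 3 → Space → ℝ} (hu : ∀ i, ContDiff ℝ 1 (u i)) (p : Space) :
    spaceDiv (fun q => ofCart fun i => u i q) p = ∑ i, fderiv ℝ (u i) p (coordDir i) := by
  unfold spaceDiv
  refine Finset.sum_congr rfl fun i _ => ?_
  rw [← fderiv_cart ((contDiff_ofCart hu).differentiable one_ne_zero p)]
  simp only [cart_ofCart]

theorem integrable_ofCart {α : Type*} [MeasurableSpace α] {μ : Measure α} {u : Fin 3 → α → ℝ}
    (hu : ∀ i, Integrable (u i) μ) : Integrable (fun p => ofCart fun i => u i p) μ :=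
  integrable_finsetSum _ fun i _ => (hu i).smul_const (coordDir i)

theorem contDiff_spaceGrad {Φ : Space → ℝ} (hΦ : ContDiff ℝ 2 Φ) (i : Fin 3) :
    ContDiff ℝ 1 fun p => spaceGrad Φ p i :=
  (hΦ.fderiv_right (m := 1) (by norm_num)).clm_apply contDiff_const

theorem memLp_spaceGrad {Φ : Space → ℝ} {μ : Measure Space} (h : MemLp (fderiv ℝ Φ) 2 μ)
    (i : Fin 3) : MemLp (fun p => spaceGrad Φ p i) 2 μ :=
  (ContinuousLinearMap.apply ℝ ℝ (coordDir i)).comp_memLp' h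

theorem spaceGrad_dotProduct_cart (Φ : Space → ℝ) (p v : Space) :
    spaceGrad Φ p ⬝ᵥ cart v = fderiv ℝ Φ p v := by
  rw [continuousLinearMap_apply_eq_sum_cart (fderiv ℝ Φ p) v]
  simp only [dotProduct, spaceGrad, mul_comm]

/-! ### Green's identity, uniqueness and symmetry of the Dirichlet-to-Neumann operator -/

section Green

variable {b f₁ f₂ : Plane → ℝ} {Φ Ψ : Space → ℝ}

/-- Green's first identity for a function and a potential. -/
theorem green (hb : ContDiff ℝ 1 b) (hpos : ∀ X, 0 < b X) (hΦ : IsPotential b f₁ Φ)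
    (hΨ : IsPotential b f₂ Ψ) (hi : Integrable fun X => f₁ X * fderiv ℝ Ψ (X, 0) (0, 1)) :
    IntegrableOn (fun p => spaceGrad Φ p ⬝ᵥ spaceGrad Ψ p) (fluidDomain 0 b) ∧
    ∫ p in fluidDomain 0 b, spaceGrad Φ p ⬝ᵥ spaceGrad Ψ p
      = ∫ X, f₁ X * fderiv ℝ Ψ (X, 0) (0, 1) := by
  have hmeas := (isOpen_fluidDomain_zero hb.continuous).measurableSet
  -- The field `Φ ∇Ψ`: its divergence is `∇Φ·∇Ψ` by harmonicity of `Ψ`, and its bottom flux vanishes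
  -- by the Neumann condition on `Ψ`.
  set u : Fin 3 → Space → ℝ := fun i p => Φ p * spaceGrad Ψ p i
  have hu : ∀ i, ContDiff ℝ 1 (u i) := fun i =>
    (hΦ.contDiff.of_le one_le_two).mul (contDiff_spaceGrad hΨ.contDiff i)
  have hdiv : ∀ p ∈ fluidDomain 0 b,
      spaceDiv (fun q => ofCart fun i => u i q) p = spaceGrad Φ p ⬝ᵥ spaceGrad Ψ p := by
    intro p hp
    rw [spaceDiv_ofCart hu]
    have h : ∀ i, fderiv ℝ (u i) p (coordDir i)
        = Φ p * fderiv ℝ (fun q => fderiv ℝ Ψ q (coordDir i)) p (coordDir i)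
          + spaceGrad Φ p i * spaceGrad Ψ p i := by
      intro i
      have h1 := (hΦ.contDiff.differentiable two_ne_zero p).hasFDerivAt.mul
        ((contDiff_spaceGrad hΨ.contDiff i).differentiable one_ne_zero p).hasFDerivAt
      refine (DFunLike.congr_fun h1.fderiv (coordDir i)).trans ?_
      simp [spaceGrad, mul_comm]
    simp only [h, Finset.sum_add_distrib, ← Finset.mul_sum]
    have := hΨ.harmonic p hp
    unfold spaceLaplacian at this
    rw [this]
    simp [dotProduct]
  have hgi : IntegrableOn (fun p => spaceGrad Φ p ⬝ᵥ spaceGrad Ψ p) (fluidDomain 0 b) :=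
    integrable_finsetSum _ fun i _ =>
      (memLp_spaceGrad hΦ.memLp_fderiv i).integrable_mul (memLp_spaceGrad hΨ.memLp_fderiv i)
  have hflux : ∀ X, (ofCart fun i => u i (X, 0)).2
      + cart (ofCart fun i => u i (X, -b X)) ⬝ᵥ cart (bottomNormal b X)
      = f₁ X * fderiv ℝ Ψ (X, 0) (0, 1) := by
    intro X
    have h1 : (fun i => u i (X, -b X)) = Φ (X, -b X) • spaceGrad Ψ (X, -b X) := rfl
    rw [cart_ofCart, ofCart_snd, h1, smul_dotProduct, spaceGrad_dotProduct_cart, hΨ.bottom X,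
      smul_zero, add_zero]
    simp only [u, hΦ.surface]
    rfl
  have key := integral_spaceDiv hb hpos (contDiff_ofCart hu)
    (integrable_ofCart fun i => hΦ.memLp.integrable_mul (memLp_spaceGrad hΨ.memLp_fderiv i))
    (hgi.congr_fun (fun p hp => (hdiv p hp).symm) hmeas)
    (by simpa only [hflux] using hi)
  simp only [hflux] at key
  rw [setIntegral_congr_fun hmeas hdiv] at key
  exact ⟨hgi, key⟩

theorem IsPotential.sub (hΦ : IsPotential b f₁ Φ) (hΨ : IsPotential b f₂ Ψ) :
    IsPotential b (f₁ - f₂) (Φ - Ψ) := by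
  have hd : ∀ p, fderiv ℝ (Φ - Ψ) p = fderiv ℝ Φ p - fderiv ℝ Ψ p := fun p =>
    fderiv_sub (hΦ.contDiff.differentiable two_ne_zero p)
      (hΨ.contDiff.differentiable two_ne_zero p)
  refine ⟨hΦ.contDiff.sub hΨ.contDiff, ?_, ?_, ?_, hΦ.memLp.sub hΨ.memLp, ?_⟩
  · intro p hp
    have h1 := hΦ.harmonic p hp
    have h2 := hΨ.harmonic p hp
    unfold spaceLaplacian at *
    have h : ∀ i, fderiv ℝ (fun q => fderiv ℝ (Φ - Ψ) q (coordDir i)) p (coordDir i)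
        = fderiv ℝ (fun q => fderiv ℝ Φ q (coordDir i)) p (coordDir i)
          - fderiv ℝ (fun q => fderiv ℝ Ψ q (coordDir i)) p (coordDir i) := by
      intro i
      simp only [hd, sub_apply]
      have e1 := (contDiff_spaceGrad hΦ.contDiff i).differentiable one_ne_zero p
      have e2 := (contDiff_spaceGrad hΨ.contDiff i).differentiable one_ne_zero p
      unfold spaceGrad at e1 e2
      rw [fderiv_fun_sub e1 e2]
      rfl
    simp only [h, Finset.sum_sub_distrib, h1, h2, sub_zero]
  · intro X
    simp [hΦ.surface, hΨ.surface]
  · intro X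
    simp [hd, hΦ.bottom, hΨ.bottom]
  · rw [show fderiv ℝ (Φ - Ψ) = fderiv ℝ Φ - fderiv ℝ Ψ from funext hd]
    exact hΦ.memLp_fderiv.sub hΨ.memLp_fderiv

theorem mem_closure_fluidDomain {X : Plane} (hpos : 0 < b X) :
    (X, 0) ∈ closure (fluidDomain 0 b) := by
  have h : Tendsto (fun z : ℝ => (X, z)) (𝓝[<] 0) (𝓝 (X, 0)) :=
    ((Continuous.prodMk_right X).tendsto 0).mono_left nhdsWithin_le_nhds
  refine mem_closure_of_tendsto h ?_
  filter_upwards [Ioo_mem_nhdsLT (neg_lt_zero.2 hpos)] with z hz using hz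

/-- The difference of the potentials has zero surface value, so Green's identity makes its Dirichlet
energy vanish. Its gradient is then zero in the open domain, and by continuity also at the surface.
-/
theorem IsPotential.surface_fderiv_eq {f : Plane → ℝ} (hb : ContDiff ℝ 1 b) (hpos : ∀ X, 0 < b X)
    (hΦ : IsPotential b f Φ) (hΨ : IsPotential b f Ψ) (X : Plane) :
    fderiv ℝ Φ (X, 0) (0, 1) = fderiv ℝ Ψ (X, 0) (0, 1) := by
  have hopen := isOpen_fluidDomain_zero hb.continuous
  have hD := hΦ.sub hΨ
  rw [sub_self] at hD
  have hcont : ∀ i, Continuous fun p => spaceGrad (Φ - Ψ) p i := fun i =>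
    (contDiff_spaceGrad hD.contDiff i).continuous
  have hc : Continuous fun p => spaceGrad (Φ - Ψ) p ⬝ᵥ spaceGrad (Φ - Ψ) p := by
    unfold dotProduct
    fun_prop
  have hnn : ∀ p, 0 ≤ spaceGrad (Φ - Ψ) p ⬝ᵥ spaceGrad (Φ - Ψ) p := fun p =>
    Finset.sum_nonneg fun i _ => mul_self_nonneg _
  obtain ⟨hgi, h0⟩ := green hb hpos hD hD (by simp)
  simp only [Pi.zero_apply, zero_mul, integral_zero] at h0
  rw [setIntegral_eq_zero_iff_of_nonneg_ae (Eventually.of_forall hnn) hgi] at h0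
  have heq : EqOn (fun p => spaceGrad (Φ - Ψ) p ⬝ᵥ spaceGrad (Φ - Ψ) p) 0 (fluidDomain 0 b) :=
    Measure.eqOn_open_of_ae_eq h0 hopen hc.continuousOn continuousOn_const
  have hz : spaceGrad (Φ - Ψ) (X, 0) ⬝ᵥ spaceGrad (Φ - Ψ) (X, 0) = 0 :=
    heq.closure hc continuous_const (mem_closure_fluidDomain (hpos X))
  have h2 : fderiv ℝ (Φ - Ψ) (X, 0) (0, 1) = 0 := congrFun (dotProduct_self_eq_zero.1 hz) 2
  rw [fderiv_sub (hΦ.contDiff.differentiable two_ne_zero _)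
    (hΨ.contDiff.differentiable two_ne_zero _), sub_apply, sub_eq_zero] at h2
  exact h2

/-- The operator is defined through a chosen potential; uniqueness of the surface derivative permits
computing it with any potential at hand. -/
theorem IsPotential.dirichletNeumann_eq {f : Plane → ℝ} (hb : ContDiff ℝ 1 b)
    (hpos : ∀ X, 0 < b X) (hΦ : IsPotential b f Φ) (X : Plane) :
    dirichletNeumann b f X = fderiv ℝ Φ (X, 0) (0, 1) := by
  have h : ∃ Φ, IsPotential b f Φ := ⟨Φ, hΦ⟩
  rw [dirichletNeumann, dif_pos h]
  exact h.choose_spec.surface_fderiv_eq hb hpos hΦ X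

/-- The Dirichlet-to-Neumann operator is symmetric. -/
theorem IsPotential.integral_mul_comm (hb : ContDiff ℝ 1 b) (hpos : ∀ X, 0 < b X)
    (hΦ : IsPotential b f₁ Φ) (hΨ : IsPotential b f₂ Ψ)
    (h₁ : Integrable fun X => f₁ X * fderiv ℝ Ψ (X, 0) (0, 1))
    (h₂ : Integrable fun X => f₂ X * fderiv ℝ Φ (X, 0) (0, 1)) :
    ∫ X, f₁ X * fderiv ℝ Ψ (X, 0) (0, 1) = ∫ X, f₂ X * fderiv ℝ Φ (X, 0) (0, 1) := by
  rw [← (green hb hpos hΦ hΨ h₁).2, ← (green hb hpos hΨ hΦ h₂).2]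
  simp only [dotProduct_comm]

end Green

/-! ### The production term as a surface flux -/

section Production

variable {V : Space → Space} {Φ : Space → ℝ}

/-- The antisymmetric part of the velocity gradient does not contribute to the quadratic form, so
the gradient itself can replace the strain. -/
theorem production_eq (V : Space → Space) (u : Space → Fin 3 → ℝ) (p : Space) :
    production V u p
      = -∑ i, ∑ j, u p i * u p j * cart (fderiv ℝ V p (coordDir i)) j := by
  simp only [production, strain, dotProduct, Matrix.mulVec, Fin.sum_univ_three, Matrix.smul_apply,
    Matrix.add_apply, Matrix.transpose_apply, Matrix.of_apply, smul_eq_mul]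
  ring

theorem abs_production_le (V : Space → Space) (Φ : Space → ℝ) (p : Space) :
    |production V (spaceGrad Φ) p| ≤ 9 * (‖fderiv ℝ V p‖ * ‖fderiv ℝ Φ p‖ ^ 2) := by
  rw [production_eq, abs_neg]
  have hg : ∀ i, |spaceGrad Φ p i| ≤ ‖fderiv ℝ Φ p‖ := fun i =>
    (fderiv ℝ Φ p).unit_le_opNorm _ (norm_coordDir_le i)
  have hV : ∀ i j, |cart (fderiv ℝ V p (coordDir i)) j| ≤ ‖fderiv ℝ V p‖ := fun i j =>
    (abs_cart_le _ j).trans ((fderiv ℝ V p).unit_le_opNorm _ (norm_coordDir_le i))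
  have ht : ∀ i j, |spaceGrad Φ p i * spaceGrad Φ p j * cart (fderiv ℝ V p (coordDir i)) j|
      ≤ ‖fderiv ℝ V p‖ * ‖fderiv ℝ Φ p‖ ^ 2 := by
    intro i j
    rw [abs_mul, abs_mul]
    calc _ ≤ ‖fderiv ℝ Φ p‖ * ‖fderiv ℝ Φ p‖ * ‖fderiv ℝ V p‖ :=
          mul_le_mul (mul_le_mul (hg i) (hg j) (abs_nonneg _) (norm_nonneg _)) (hV i j)
            (abs_nonneg _) (by positivity)
      _ = _ := by ring
  calc _ ≤ ∑ i : Fin 3, ∑ j : Fin 3, ‖fderiv ℝ V p‖ * ‖fderiv ℝ Φ p‖ ^ 2 :=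
        (Finset.abs_sum_le_sum_abs _ _).trans (Finset.sum_le_sum fun i _ =>
          (Finset.abs_sum_le_sum_abs _ _).trans (Finset.sum_le_sum fun j _ => ht i j))
    _ = _ := by simp; ring

theorem continuous_production (hV : ContDiff ℝ 1 V) (hΦ : ContDiff ℝ 2 Φ) :
    Continuous (production V (spaceGrad Φ)) := by
  rw [show production V (spaceGrad Φ) = _ from funext (production_eq V (spaceGrad Φ))]
  have h1 : ∀ i, Continuous fun p => spaceGrad Φ p i := fun i =>
    (contDiff_spaceGrad hΦ i).continuous
  have h2 := hV.continuous_fderiv one_ne_zero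
  simp only [cart_eq_cartCoord]
  fun_prop

/-- The divergence of `(V · ∇Φ) ∇Φ - |∇Φ|² V / 2` is `∇Φ · S(V) ∇Φ` where `Φ` is harmonic and `V`
is divergence free. -/
theorem spaceDiv_stress (hV : ContDiff ℝ 1 V) (hΦ : ContDiff ℝ 2 Φ) {p : Space}
    (hdiv : spaceDiv V p = 0) (hharm : spaceLaplacian Φ p = 0) :
    spaceDiv (fun q => ofCart fun i => (spaceGrad Φ q ⬝ᵥ cart (V q)) * spaceGrad Φ q i
      - 1 / 2 * (spaceGrad Φ q ⬝ᵥ spaceGrad Φ q) * cart (V q) i) p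
      = -production V (spaceGrad Φ) p := by
  have hg := contDiff_spaceGrad hΦ
  have hc := contDiff_cart hV
  rw [spaceDiv_ofCart (u := fun i q => (spaceGrad Φ q ⬝ᵥ cart (V q)) * spaceGrad Φ q i
      - 1 / 2 * (spaceGrad Φ q ⬝ᵥ spaceGrad Φ q) * cart (V q) i)
    (fun i => by unfold dotProduct; fun_prop)]
  let H : Fin 3 → Fin 3 → ℝ := fun i j =>
    fderiv ℝ (fun q => spaceGrad Φ q j) p (coordDir i)
  have hsymm : ∀ i j, H i j = H j i := by
    have hd : ∀ i j, H i j = fderiv ℝ (fderiv ℝ Φ) p (coordDir i) (coordDir j) := by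
      intro i j
      have h1 := ((hΦ.fderiv_right (m := 1) (by norm_num)).differentiable one_ne_zero
        p).hasFDerivAt
      have h2 := h1.clm_apply (hasFDerivAt_const (coordDir j) p)
      simp only [H, spaceGrad]
      rw [h2.fderiv]
      simp
    intro i j
    rw [hd, hd]
    exact (hΦ.contDiffAt.isSymmSndFDerivAt (by simp)) _ _
  let J : Fin 3 → Fin 3 → ℝ := fun i j => cart (fderiv ℝ V p (coordDir i)) j
  have hterm : ∀ i, fderiv ℝ (fun q => (spaceGrad Φ q ⬝ᵥ cart (V q)) * spaceGrad Φ q i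
      - 1 / 2 * (spaceGrad Φ q ⬝ᵥ spaceGrad Φ q) * cart (V q) i) p (coordDir i)
      = (∑ j, (H i j * cart (V p) j + spaceGrad Φ p j * J i j)) * spaceGrad Φ p i
        + (spaceGrad Φ p ⬝ᵥ cart (V p)) * H i i
        - (∑ j, H i j * spaceGrad Φ p j) * cart (V p) i
        - 1 / 2 * (spaceGrad Φ p ⬝ᵥ spaceGrad Φ p) * J i i := by
    intro i
    have hgd : ∀ j, HasFDerivAt (fun q => spaceGrad Φ q j)
        (fderiv ℝ (fun q => spaceGrad Φ q j) p) p := fun j =>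
      ((hg j).differentiable one_ne_zero p).hasFDerivAt
    have hcd : ∀ j, HasFDerivAt (fun q => cart (V q) j)
        (fderiv ℝ (fun q => cart (V q) j) p) p := fun j =>
      ((hc j).differentiable one_ne_zero p).hasFDerivAt
    have h1 : HasFDerivAt (fun q => spaceGrad Φ q ⬝ᵥ cart (V q)) _ p :=
      HasFDerivAt.fun_sum fun j _ => (hgd j).mul (hcd j)
    have h2 : HasFDerivAt (fun q => spaceGrad Φ q ⬝ᵥ spaceGrad Φ q) _ p :=
      HasFDerivAt.fun_sum fun j _ => (hgd j).mul (hgd j)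
    have h3 := (h1.mul (hgd i)).sub ((h2.const_mul (1 / 2)).mul (hcd i))
    refine (DFunLike.congr_fun h3.fderiv (coordDir i)).trans ?_
    have hHi : ∀ j, fderiv ℝ (fun q => spaceGrad Φ q j) p (coordDir i) = H i j := fun _ => rfl
    have hJi : ∀ j, fderiv ℝ (fun q => cart (V q) j) p (coordDir i) = J i j := fun j =>
      fderiv_cart (hV.differentiable one_ne_zero p) j _
    simp only [sub_apply, add_apply, smul_apply, smul_eq_mul, Fin.sum_univ_three, hJi, hHi]
    ring
  simp only [hterm]
  have hd0 : ∑ i, J i i = 0 := hdiv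
  have hl0 : ∑ i, H i i = 0 := hharm
  rw [production_eq, neg_neg]
  simp only [Fin.sum_univ_three, dotProduct] at hd0 hl0 ⊢
  -- Symmetry of the Hessian cancels `∑ H i j Vⱼ ∂ᵢΦ` against `∑ H i j ∂ⱼΦ Vᵢ`. The remaining excess
  -- is `V·∇Φ` times the Laplacian minus `½|∇Φ|²` times the divergence of `V`.
  rw [hsymm 1 0, hsymm 2 0, hsymm 2 1]
  linear_combination (spaceGrad Φ p 0 * cart (V p) 0 + spaceGrad Φ p 1 * cart (V p) 1
    + spaceGrad Φ p 2 * cart (V p) 2) * hl0 - 1 / 2 * (spaceGrad Φ p 0 * spaceGrad Φ p 0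
      + spaceGrad Φ p 1 * spaceGrad Φ p 1 + spaceGrad Φ p 2 * spaceGrad Φ p 2) * hd0

/-- The production in the bulk as an integral over the surface. -/
theorem integral_production {b f : Plane → ℝ} (hb : ContDiff ℝ 1 b) (hpos : ∀ X, 0 < b X)
    (hΦ : IsPotential b f Φ) (hV : ContDiff ℝ 1 V)
    (hdiv : ∀ p ∈ fluidDomain 0 b, spaceDiv V p = 0)
    (hbot : ∀ X, cart (V (X, -b X)) ⬝ᵥ cart (bottomNormal b X) = 0) {k₀ k₁ : ℝ}
    (hk₀ : ∀ p ∈ fluidDomain 0 b, ‖V p‖ ≤ k₀) (hk₁ : ∀ p ∈ fluidDomain 0 b, ‖fderiv ℝ V p‖ ≤ k₁)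
    (hi : Integrable fun X => fderiv ℝ Φ (X, 0) (V (X, 0)) * fderiv ℝ Φ (X, 0) (0, 1)
      - 1 / 2 * (spaceGrad Φ (X, 0) ⬝ᵥ spaceGrad Φ (X, 0)) * (V (X, 0)).2) :
    IntegrableOn (production V (spaceGrad Φ)) (fluidDomain 0 b) ∧
    ∫ p in fluidDomain 0 b, production V (spaceGrad Φ) p
      = -∫ X, (fderiv ℝ Φ (X, 0) (V (X, 0)) * fderiv ℝ Φ (X, 0) (0, 1)
      - 1 / 2 * (spaceGrad Φ (X, 0) ⬝ᵥ spaceGrad Φ (X, 0)) * (V (X, 0)).2) := by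
  have hmeas := (isOpen_fluidDomain_zero hb.continuous).measurableSet
  have hg := contDiff_spaceGrad hΦ.contDiff
  have hc := contDiff_cart hV
  have hP : IntegrableOn (production V (spaceGrad Φ)) (fluidDomain 0 b) := by
    refine Integrable.mono' ((hΦ.memLp_fderiv.integrable_norm_pow two_ne_zero).const_mul (9 * k₁))
      (continuous_production hV hΦ.contDiff).aestronglyMeasurable ?_
    filter_upwards [ae_restrict_mem hmeas] with p hp
    refine (abs_production_le V Φ p).trans ?_
    have := mul_le_mul_of_nonneg_right (hk₁ p hp) (sq_nonneg ‖fderiv ℝ Φ p‖)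
    linarith
  set u : Fin 3 → Space → ℝ := fun i q => (spaceGrad Φ q ⬝ᵥ cart (V q)) * spaceGrad Φ q i
      - 1 / 2 * (spaceGrad Φ q ⬝ᵥ spaceGrad Φ q) * cart (V q) i with hu_def
  have hu : ∀ i, ContDiff ℝ 1 (u i) := fun i => by
    simp only [hu_def]
    unfold dotProduct
    fun_prop
  have hdivu : ∀ p ∈ fluidDomain 0 b,
      spaceDiv (fun q => ofCart fun i => u i q) p = -production V (spaceGrad Φ) p := fun p hp =>
    spaceDiv_stress hV hΦ.contDiff (hdiv p hp) (hΦ.harmonic p hp)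
  have hflux : ∀ X, (ofCart fun i => u i (X, 0)).2
      + cart (ofCart fun i => u i (X, -b X)) ⬝ᵥ cart (bottomNormal b X)
      = fderiv ℝ Φ (X, 0) (V (X, 0)) * fderiv ℝ Φ (X, 0) (0, 1)
      - 1 / 2 * (spaceGrad Φ (X, 0) ⬝ᵥ spaceGrad Φ (X, 0)) * (V (X, 0)).2 := by
    intro X
    -- At the bottom the field is a combination of `∇Φ` and `V`, both orthogonal to the normal.
    have h1 : (fun i => u i (X, -b X))
        = (spaceGrad Φ (X, -b X) ⬝ᵥ cart (V (X, -b X))) • spaceGrad Φ (X, -b X)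
          - (1 / 2 * (spaceGrad Φ (X, -b X) ⬝ᵥ spaceGrad Φ (X, -b X))) • cart (V (X, -b X)) := rfl
    rw [cart_ofCart, ofCart_snd, h1, sub_dotProduct, smul_dotProduct, smul_dotProduct,
      spaceGrad_dotProduct_cart Φ _ (bottomNormal b X), hΦ.bottom X, hbot X, smul_zero, smul_zero,
      sub_zero, add_zero]
    simp only [hu_def, spaceGrad_dotProduct_cart]
    rfl
  have hui : ∀ i, IntegrableOn (u i) (fluidDomain 0 b) := by
    intro i
    have hgg : ∀ j, MemLp (fun p => spaceGrad Φ p j) 2 (volume.restrict (fluidDomain 0 b)) :=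
      memLp_spaceGrad hΦ.memLp_fderiv
    have hb : ∀ j, ∀ᵐ p ∂volume.restrict (fluidDomain 0 b), ‖cart (V p) j‖ ≤ k₀ := by
      intro j
      filter_upwards [ae_restrict_mem hmeas] with p hp
      exact (abs_cart_le _ j).trans (hk₀ p hp)
    have hcm : ∀ j, AEStronglyMeasurable (fun p => cart (V p) j)
        (volume.restrict (fluidDomain 0 b)) := fun j => (hc j).continuous.aestronglyMeasurable
    have e1 : ∀ q, u i q = ∑ j, spaceGrad Φ q j * spaceGrad Φ q i * cart (V q) j
        - 1 / 2 * ∑ j, spaceGrad Φ q j * spaceGrad Φ q j * cart (V q) i := by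
      intro q
      simp only [hu_def, dotProduct, Fin.sum_univ_three]
      ring
    rw [show u i = _ from funext e1]
    refine Integrable.sub (integrable_finsetSum _ fun j _ => ?_)
      (Integrable.const_mul (integrable_finsetSum _ fun j _ => ?_) _)
    · exact Integrable.mul_bdd (c := k₀) ((hgg j).integrable_mul (hgg i)) (hcm j) (hb j)
    · exact Integrable.mul_bdd (c := k₀) ((hgg j).integrable_mul (hgg j)) (hcm i) (hb i)
  have key := integral_spaceDiv hb hpos (contDiff_ofCart hu) (integrable_ofCart hui)
    (hP.neg.congr_fun (fun p hp => (hdivu p hp).symm) hmeas)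
    (by simpa only [hflux] using hi)
  simp only [hflux] at key
  rw [setIntegral_congr_fun hmeas hdivu, integral_neg] at key
  exact ⟨hP, by rw [← key, neg_neg]⟩

end Production

/-! ### Differentiating integrals of products in time -/

theorem MeasureTheory.MemLp.integrable_fun_mul {α : Type*} [MeasurableSpace α] {μ : Measure α}
    {f g : α → ℝ}
    (hf : MemLp f 2 μ) (hg : MemLp g 2 μ) : Integrable (fun x => f x * g x) μ :=
  MemLp.integrable_mul hf hg

/-- Near the time `t`, the functions `a s` are continuous and differentiable in `s`, and dominated,
together with their time derivatives, by `h`. -/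
structure HasDominatedDeriv (h : Plane → ℝ) (a : ℝ → Plane → ℝ) (t : ℝ) : Prop where
  eventually : ∀ᶠ s in 𝓝 t, Continuous (a s) ∧ ∀ X, DifferentiableAt ℝ (fun r => a r X) s ∧
    |a s X| ≤ h X ∧ |deriv (fun r => a r X) s| ≤ h X
  continuous_deriv : Continuous fun X => deriv (fun r => a r X) t

namespace HasDominatedDeriv

variable {h : Plane → ℝ} {a c : ℝ → Plane → ℝ} {t : ℝ}

/-- Freezing one factor at time `t` isolates one half of the product rule, which is how symmetry of
the operator gets differentiated. -/
theorem const (ha : HasDominatedDeriv h a t) : HasDominatedDeriv h (fun _ => a t) t := by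
  have h0 := ha.eventually.self_of_nhds
  refine ⟨Eventually.of_forall fun s => ⟨h0.1, fun X =>
    ⟨differentiableAt_const _, (h0.2 X).2.1, ?_⟩⟩, ?_⟩
  · simpa using (abs_nonneg _).trans (h0.2 X).2.1
  · simpa using continuous_const

theorem memLp (hh : MemLp h 2 volume) (ha : HasDominatedDeriv h a t) : MemLp (a t) 2 volume :=
  hh.mono' ha.eventually.self_of_nhds.1.aestronglyMeasurable
    (Eventually.of_forall fun X => (ha.eventually.self_of_nhds.2 X).2.1)

theorem memLp_deriv (hh : MemLp h 2 volume) (ha : HasDominatedDeriv h a t) :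
    MemLp (fun X => deriv (fun r => a r X) t) 2 volume :=
  hh.mono' ha.continuous_deriv.aestronglyMeasurable
    (Eventually.of_forall fun X => (ha.eventually.self_of_nhds.2 X).2.2)

/-- Dominated differentiation: both terms of the product rule are bounded by `h²`, which is
integrable as `h` is square integrable. -/
theorem hasDerivAt_integral_mul (hh : MemLp h 2 volume) (ha : HasDominatedDeriv h a t)
    (hc : HasDominatedDeriv h c t) :
    HasDerivAt (fun s => ∫ X, a s X * c s X)
      ((∫ X, deriv (fun r => a r X) t * c t X) + ∫ X, a t X * deriv (fun r => c r X) t) t := by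
  have hint : Integrable fun X => h X * h X + h X * h X :=
    (hh.integrable_mul hh).add (hh.integrable_mul hh)
  obtain ⟨ha1, ha2⟩ := ha.eventually.self_of_nhds
  obtain ⟨hc1, hc2⟩ := hc.eventually.self_of_nhds
  rw [← integral_add ((ha.memLp_deriv hh).integrable_fun_mul (hc.memLp hh))
    ((ha.memLp hh).integrable_fun_mul (hc.memLp_deriv hh))]
  have key := hasDerivAt_integral_of_dominated_loc_of_deriv_le (μ := (volume : Measure Plane))
    (F := fun s X => a s X * c s X)
    (F' := fun s X => deriv (fun r => a r X) s * c s X + a s X * deriv (fun r => c r X) s)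
    (bound := fun X => h X * h X + h X * h X) (ha.eventually.and hc.eventually)
    ?_ ((ha.memLp hh).integrable_fun_mul (hc.memLp hh)) ?_ ?_ hint ?_
  · exact key.2
  · filter_upwards [ha.eventually, hc.eventually] with s h1 h2
    exact (h1.1.mul h2.1).aestronglyMeasurable
  · exact ((ha.continuous_deriv.mul hc1).add (ha1.mul hc.continuous_deriv)).aestronglyMeasurable
  · refine Eventually.of_forall fun X s hs => ?_
    obtain ⟨-, h2, h3⟩ := hs.1.2 X
    obtain ⟨-, h5, h6⟩ := hs.2.2 X
    have h0 : 0 ≤ h X := (abs_nonneg _).trans h2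
    refine (abs_add_le _ _).trans (add_le_add ?_ ?_) <;> rw [abs_mul] <;> gcongr
  · exact Eventually.of_forall fun X s hs =>
      (hs.1.2 X).1.hasDerivAt.mul (hs.2.2 X).1.hasDerivAt

/-- The time derivative of a slice is the joint derivative in the direction `(1, 0)`, so space-time
bounds yield the domination. -/
theorem of_contDiffOn {I : Set ℝ} (hI : IsOpen I) (ht : t ∈ I) {Ψ : ℝ × Plane → ℝ}
    (hΨ : ContDiffOn ℝ 1 Ψ (I ×ˢ univ)) (ha : ∀ s ∈ I, ∀ X, a s X = Ψ (s, X))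
    (hle : ∀ᶠ s in 𝓝 t, ∀ X, |Ψ (s, X)| ≤ h X ∧ |fderiv ℝ Ψ (s, X) (1, 0)| ≤ h X) :
    HasDominatedDeriv h a t := by
  have hopen : IsOpen (I ×ˢ (univ : Set Plane)) := hI.prod isOpen_univ
  have hmem : ∀ s ∈ I, ∀ X : Plane, (s, X) ∈ I ×ˢ (univ : Set Plane) := fun s hs X => ⟨hs, trivial⟩
  have hd : ∀ s ∈ I, ∀ X, HasDerivAt (fun r => a r X) (fderiv ℝ Ψ (s, X) (1, 0)) s := by
    intro s hs X
    have h1 := ((hΨ.contDiffAt (hopen.mem_nhds (hmem s hs X))).differentiableAt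
      one_ne_zero).hasFDerivAt.comp_hasDerivAt s ((hasDerivAt_id s).prodMk (hasDerivAt_const s X))
    refine h1.congr_of_eventuallyEq ?_
    filter_upwards [hI.mem_nhds hs] with r hr using ha r hr X
  refine ⟨?_, ?_⟩
  · filter_upwards [hI.mem_nhds ht, hle] with s hs hX
    refine ⟨?_, fun X => ⟨(hd s hs X).differentiableAt, ?_, ?_⟩⟩
    · rw [show a s = _ from funext (ha s hs)]
      exact hΨ.continuousOn.comp_continuous (Continuous.prodMk_right s) (hmem s hs)
    · rw [ha s hs]
      exact (hX X).1
    · rw [(hd s hs X).deriv]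
      exact (hX X).2
  · simp only [fun X => (hd t ht X).deriv]
    exact ((hΨ.continuousOn_fderiv_of_isOpen hopen le_rfl).comp_continuous
      (Continuous.prodMk_right t) (hmem t ht)).clm_apply continuous_const

end HasDominatedDeriv

/-! ### Surface traces, the vertical current, and the rate of change of the energy -/

section Waves

variable {I : Set ℝ} {b : Plane → ℝ} {η φ : ℝ → Plane → ℝ} {Φ : ℝ → Space → ℝ} {t : ℝ}

theorem norm_iteratedFDeriv_two {E F : Type*} [NormedAddCommGroup E] [NormedSpace ℝ E]
    [NormedAddCommGroup F] [NormedSpace ℝ F] (f : E → F) (x : E) :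
    ‖iteratedFDeriv ℝ 2 f x‖ = ‖fderiv ℝ (fderiv ℝ f) x‖ := by
  rw [← norm_iteratedFDeriv_fderiv (n := 1), norm_iteratedFDeriv_one]

/-- The surface traces of a smooth and decaying wave are dominated together with their time
derivatives. -/
theorem IsSmoothDecaying.exists_dominated (hI : IsOpen I) (hpos : ∀ X, 0 < b X)
    (hS : IsSmoothDecaying I b η Φ) (ht : t ∈ I) :
    ∃ h : Plane → ℝ, MemLp h 2 volume ∧ HasDominatedDeriv h η t ∧
      HasDominatedDeriv h (fun s X => Φ s (X, 0)) t ∧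
      HasDominatedDeriv h (fun s X => fderiv ℝ (Φ s) (X, 0) (0, 1)) t ∧
      ∀ X, ‖fderiv ℝ (Φ t) (X, 0)‖ ≤ h X := by
  obtain ⟨h, hh, hev⟩ := hS.decay t ht
  set J : ℝ × Space → ℝ := fun q => Φ q.1 q.2
  have hopen : IsOpen (I ×ˢ (univ : Set Space)) := hI.prod isOpen_univ
  have hmem : ∀ s ∈ I, ∀ p : Space, (s, p) ∈ I ×ˢ (univ : Set Space) := fun s hs p => ⟨hs, trivial⟩
  have hJd : ∀ s ∈ I, ∀ p, HasFDerivAt J (fderiv ℝ J (s, p)) (s, p) := fun s hs p =>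
    ((hS.contDiff_potential.contDiffAt (hopen.mem_nhds (hmem s hs p))).differentiableAt
      three_ne_zero).hasFDerivAt
  have hD : ContDiffOn ℝ 1 (fderiv ℝ J) (I ×ˢ univ) :=
    hS.contDiff_potential.fderiv_of_isOpen hopen (by norm_num)
  have hDd : ∀ s ∈ I, ∀ p, HasFDerivAt (fderiv ℝ J) (fderiv ℝ (fderiv ℝ J) (s, p)) (s, p) :=
    fun s hs p => ((hD.contDiffAt (hopen.mem_nhds (hmem s hs p))).differentiableAt
      one_ne_zero).hasFDerivAt
  have hslice : ∀ s ∈ I, ∀ p, fderiv ℝ (Φ s) p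
      = (fderiv ℝ J (s, p)).comp (ContinuousLinearMap.inr ℝ ℝ Space) := fun s hs p =>
    (HasFDerivAt.comp (f := fun q : Space => (s, q)) p (hJd s hs p)
      (hasFDerivAt_prodMk_right s p)).fderiv
  -- The surface `z = 0` in space-time. Traces are compositions with `ι`; the trace of `∂_z Φ` costs
  -- a second derivative of `Φ` once it is differentiated in time.
  let ι : ℝ × Plane →L[ℝ] ℝ × Space :=
    (ContinuousLinearMap.id ℝ ℝ).prodMap (ContinuousLinearMap.inl ℝ Plane ℝ)
  have hι : ∀ s X, ι (s, X) = (s, (X, 0)) := fun _ _ => rfl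
  have hιm : MapsTo ι (I ×ˢ univ) (I ×ˢ univ) := fun q hq => ⟨hq.1, trivial⟩
  have n1 : ‖ι (1, 0)‖ ≤ 1 := by simp [hι, Prod.norm_def]
  have n2 : ‖((0, (0, 1)) : ℝ × Space)‖ ≤ 1 := by simp [Prod.norm_def]
  have hev0 : ∀ᶠ s in 𝓝 t, s ∈ I ∧ ∀ X, |J (s, (X, 0))| ≤ h X ∧ ‖fderiv ℝ J (s, (X, 0))‖ ≤ h X ∧
      ‖fderiv ℝ (fderiv ℝ J) (s, (X, 0))‖ ≤ h X := by
    filter_upwards [hev, hI.mem_nhds ht] with s hs hsI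
    refine ⟨hsI, fun X => ?_⟩
    have h1 := (hs X).2 0 (by linarith [hpos X]) le_rfl
    have e0 := h1 0 (by norm_num)
    have e1 := h1 1 (by norm_num)
    have e2 := h1 2 (by norm_num)
    rw [norm_iteratedFDeriv_zero] at e0
    rw [norm_iteratedFDeriv_one] at e1
    rw [norm_iteratedFDeriv_two] at e2
    exact ⟨e0, e1, e2⟩
  refine ⟨h, hh, ?_, ?_, ?_, ?_⟩
  · refine HasDominatedDeriv.of_contDiffOn hI ht hS.contDiff_elevation (fun _ _ _ => rfl) ?_
    filter_upwards [hev] with s hs X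
    have e0 := (hs X).1 0 (by norm_num)
    have e1 := (hs X).1 1 (by norm_num)
    rw [norm_iteratedFDeriv_zero] at e0
    rw [norm_iteratedFDeriv_one] at e1
    refine ⟨e0, le_trans ?_ e1⟩
    refine (fderiv ℝ (fun q : ℝ × Plane => η q.1 q.2) (s, X)).unit_le_opNorm _ ?_
    simp [Prod.norm_def]
  · refine HasDominatedDeriv.of_contDiffOn hI ht (Ψ := J ∘ ι)
      ((hS.contDiff_potential.of_le (by norm_num)).comp ι.contDiff.contDiffOn hιm)
      (fun _ _ _ => rfl) ?_
    filter_upwards [hev0] with s hs X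
    refine ⟨(hs.2 X).1, ?_⟩
    have e := HasFDerivAt.comp (s, X) (hJd s hs.1 (X, 0)) ι.hasFDerivAt
    rw [e.fderiv, ContinuousLinearMap.comp_apply]
    exact (ContinuousLinearMap.unit_le_opNorm _ _ n1).trans (hs.2 X).2.1
  · refine HasDominatedDeriv.of_contDiffOn hI ht
      (Ψ := fun q => fderiv ℝ J (ι q) ((0, (0, 1)) : ℝ × Space))
      ((hD.comp ι.contDiff.contDiffOn hιm).clm_apply contDiffOn_const) ?_ ?_
    · intro s hs X
      rw [hslice s hs]
      rfl
    · filter_upwards [hev0] with s hs X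
      refine ⟨(ContinuousLinearMap.unit_le_opNorm _ _ n2).trans (hs.2 X).2.1, ?_⟩
      have e := (HasFDerivAt.comp (s, X) (hDd s hs.1 (X, 0)) ι.hasFDerivAt).clm_apply
        (hasFDerivAt_const ((0, (0, 1)) : ℝ × Space) (s, X))
      refine le_trans (le_of_eq (congrArg abs (DFunLike.congr_fun e.fderiv (1, 0)))) ?_
      have e3 : |fderiv ℝ (fderiv ℝ J) (s, (X, 0)) (ι (1, 0)) ((0, (0, 1)) : ℝ × Space)|
          ≤ ‖fderiv ℝ (fderiv ℝ J) (s, (X, 0))‖ :=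
        ((fderiv ℝ (fderiv ℝ J) (s, (X, 0)) (ι (1, 0))).unit_le_opNorm _ n2).trans
          (ContinuousLinearMap.unit_le_opNorm _ _ n1)
      simpa using e3.trans (hs.2 X).2.2
  · intro X
    obtain ⟨-, h0⟩ := hev0.self_of_nhds
    rw [hslice t ht]
    refine le_trans (ContinuousLinearMap.opNorm_le_bound _ (norm_nonneg _) fun v => ?_) (h0 X).2.1
    refine ((fderiv ℝ J (t, (X, 0))).le_opNorm (0, v)).trans (le_of_eq ?_)
    rw [Prod.norm_def (0, v), norm_zero, max_eq_right (norm_nonneg v)]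

theorem planeDiv_smul {f : Plane → ℝ} {V : Plane → Plane} {X : Plane}
    (hf : DifferentiableAt ℝ f X) (hV : DifferentiableAt ℝ V X) :
    planeDiv (fun Y => f Y • V Y) X = f X * planeDiv V X + fderiv ℝ f X (V X) := by
  have h := (hf.hasFDerivAt.smul hV.hasFDerivAt).fderiv
  have h' : fderiv ℝ (fun Y => f Y • V Y) X = _ := h
  simp only [planeDiv, h', Fin.sum_univ_two, fderiv_apply_eq_inner_gradient]
  simp [fderiv_apply_eq_inner_gradient]
  ring

theorem abs_planeDiv_le (V : Plane → Plane) (X : Plane) : |planeDiv V X| ≤ 2 * ‖fderiv ℝ V X‖ := by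
  have h : ∀ i : Fin 2, |(fderiv ℝ V X (EuclideanSpace.single i 1)) i| ≤ ‖fderiv ℝ V X‖ := by
    intro i
    refine (PiLp.norm_apply_le (fderiv ℝ V X (EuclideanSpace.single i 1)) i).trans
      (ContinuousLinearMap.unit_le_opNorm _ _ ?_)
    simp
  rw [planeDiv, Fin.sum_univ_two]
  exact (abs_add_le _ _).trans (by linarith [h 0, h 1])

theorem contDiff_slice {E F : Type*} [NormedAddCommGroup E] [NormedSpace ℝ E]
    [NormedAddCommGroup F] [NormedSpace ℝ F] {f : ℝ → E → F} {n : WithTop ℕ∞}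
    (hf : ContDiffOn ℝ n (fun q : ℝ × E => f q.1 q.2) (I ×ˢ univ)) (ht : t ∈ I) :
    ContDiff ℝ n (f t) := by
  rw [← contDiffOn_univ]
  exact hf.comp (f := fun x : E => (t, x)) (contDiff_prodMk_right t).contDiffOn
    fun x _ => ⟨ht, trivial⟩

section Trace

variable {f : Plane → ℝ} {Ψ : Space → ℝ}

theorem IsPotential.fderiv_trace (hΨ : IsPotential b f Ψ) (X v : Plane) :
    fderiv ℝ f X v = fderiv ℝ Ψ (X, 0) (v, 0) := by
  have h := HasFDerivAt.comp (f := fun Y : Plane => (Y, (0 : ℝ))) X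
    (hΨ.contDiff.differentiable two_ne_zero (X, 0)).hasFDerivAt (hasFDerivAt_prodMk_left X 0)
  have hf : f = Ψ ∘ fun Y : Plane => (Y, (0 : ℝ)) := funext fun Y => (hΨ.surface Y).symm
  rw [hf, h.fderiv]
  rfl

theorem IsPotential.spaceGrad_sq (hΨ : IsPotential b f Ψ) (X : Plane) :
    spaceGrad Ψ (X, 0) ⬝ᵥ spaceGrad Ψ (X, 0)
      = ‖gradient f X‖ ^ 2 + fderiv ℝ Ψ (X, 0) (0, 1) ^ 2 := by
  have h : ∀ i : Fin 2, gradient f X i = fderiv ℝ Ψ (X, 0) (EuclideanSpace.single i 1, 0) := by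
    intro i
    rw [← hΨ.fderiv_trace, fderiv_apply_eq_inner_gradient]
    fin_cases i <;> simp
  rw [EuclideanSpace.norm_sq_eq]
  simp [Fin.sum_univ_two, Fin.sum_univ_three, dotProduct, spaceGrad, coordDir, h, sq]

end Trace

/-- The vertical current at the mean level is small. -/
theorem IsBackground.abs_vertical_le {δ A : ℝ} {K : ℕ → ℝ} {U : ℝ → Space → Space}
    {ζ : ℝ → Plane → ℝ} (hU : IsBackground I b δ K A U ζ) (hδ : 0 < δ) (hδ1 : δ < 1)
    (hpos : ∀ X, 0 < b X) (ht : t ∈ I) (X : Plane) :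
    |(U t (X, 0)).2| ≤ A * (1 + K 0 + K 1) * δ := by
  have hV : ContDiff ℝ 1 (U t) := (contDiff_slice hU.contDiff ht).of_le (by simp)
  have hA : 0 ≤ A * δ := (abs_nonneg _).trans (hU.elevation_le t ht X)
  have hb := hpos X
  have hζ := hU.depth_pos t ht X
  have hK : ∀ z, -b X ≤ z → z ≤ max 0 (ζ t X) → ‖U t (X, z)‖ ≤ K 0 ∧
      ‖fderiv ℝ (U t) (X, z)‖ ≤ K 1 * δ := by
    intro z h1 h2
    have e0 := hU.slow t ht X z h1 h2 0
    have e1 := hU.slow t ht X z h1 h2 1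
    rw [norm_iteratedFDeriv_zero] at e0
    rw [norm_iteratedFDeriv_one] at e1
    exact ⟨by simpa using e0, by simpa using e1⟩
  have hK0 := (hK 0 (by linarith) (le_max_left _ _))
  have hK0n : 0 ≤ K 0 := (norm_nonneg _).trans hK0.1
  have hK1n : 0 ≤ K 1 * δ := (norm_nonneg _).trans hK0.2
  have hK1 : 0 ≤ K 1 := nonneg_of_mul_nonneg_left hK1n hδ
  have h1 : |(U t (X, ζ t X)).2| ≤ A * δ + A * δ * K 0 := by
    rw [← hU.kinematic t ht X]
    refine (abs_add_le _ _).trans (add_le_add (hU.deriv_elevation_le t ht X) ?_)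
    refine (ContinuousLinearMap.le_opNorm _ _).trans (mul_le_mul (hU.grad_elevation_le t ht X) ?_
      (norm_nonneg _) hA)
    exact (norm_fst_le _).trans (hK _ hζ.le (le_max_right _ _)).1
  -- Whatever the sign of `ζ`, the vertical segment from `0` to `ζ` lies between `-b` and `max 0 ζ`,
  -- where the gradient bound is available.
  have h2 : ‖U t (X, 0) - U t (X, ζ t X)‖ ≤ K 1 * δ * ‖(0 : ℝ) - ζ t X‖ := by
    refine (convex_uIcc (0 : ℝ) (ζ t X)).norm_image_sub_le_of_norm_hasDerivWithin_le
      (f := fun z => U t (X, z)) (f' := fun z => fderiv ℝ (U t) (X, z) (0, 1)) (fun z _ => ?_)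
      (fun z hz => ?_) right_mem_uIcc left_mem_uIcc
    · exact ((hV.differentiable one_ne_zero (X, z)).hasFDerivAt.comp_hasDerivAt z
        ((hasDerivAt_const z X).prodMk (hasDerivAt_id z))).hasDerivWithinAt
    · refine (ContinuousLinearMap.unit_le_opNorm _ _ ?_).trans (hK z ?_ ?_).2
      · simp [Prod.norm_def]
      · rw [uIcc, mem_Icc] at hz
        exact (le_inf (by linarith) hζ.le).trans hz.1
      · rw [uIcc, mem_Icc] at hz
        exact hz.2
  have h3 : |(U t (X, 0)).2 - (U t (X, ζ t X)).2| ≤ K 1 * (A * δ) := by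
    refine (norm_snd_le (U t (X, 0) - U t (X, ζ t X))).trans (h2.trans ?_)
    rw [zero_sub, norm_neg, mul_assoc]
    refine mul_le_mul_of_nonneg_left ?_ hK1
    have : ‖ζ t X‖ ≤ A * δ := hU.elevation_le t ht X
    calc δ * ‖ζ t X‖ ≤ 1 * (A * δ) := mul_le_mul hδ1.le this (norm_nonneg _) zero_le_one
      _ = A * δ := one_mul _
  have h4 := abs_add_le ((U t (X, 0)).2 - (U t (X, ζ t X)).2) (U t (X, ζ t X)).2
  rw [sub_add_cancel] at h4
  linarith

/-- Integrability of the energy and its rate of change, in terms of the surface traces. -/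
theorem hasDerivAt_energy {g : ℝ} (hI : IsOpen I) (hb : ContDiff ℝ 1 b) (hpos : ∀ X, 0 < b X)
    (hΦ : ∀ t ∈ I, IsPotential b (φ t) (Φ t)) (ht : t ∈ I) {h : Plane → ℝ}
    (hh : MemLp h 2 volume) (hη : HasDominatedDeriv h η t)
    (ha : HasDominatedDeriv h (fun s X => Φ s (X, 0)) t)
    (hc : HasDominatedDeriv h (fun s X => fderiv ℝ (Φ s) (X, 0) (0, 1)) t) :
    Integrable (energyDensity g b (η t) (φ t)) ∧
    HasDerivAt (fun s => ∫ X, energyDensity g b (η s) (φ s) X)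
      (∫ X, (g * η t X * deriv (fun s => η s X) t
        + deriv (fun s => Φ s (X, 0)) t * fderiv ℝ (Φ t) (X, 0) (0, 1))) t := by
  have hden : ∀ s ∈ I, ∀ X, energyDensity g b (η s) (φ s) X = 1 / 2 * g * (η s X * η s X)
      + 1 / 2 * (Φ s (X, 0) * fderiv ℝ (Φ s) (X, 0) (0, 1)) := by
    intro s hs X
    rw [energyDensity, (hΦ s hs).dirichletNeumann_eq hb hpos, (hΦ s hs).surface]
    ring
  have hL2 : ∀ {a : ℝ → Plane → ℝ}, HasDominatedDeriv h a t →
      ∀ᶠ s in 𝓝 t, MemLp (a s) 2 volume := by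
    intro a hd
    filter_upwards [hd.eventually] with s hs
    exact hh.mono' hs.1.aestronglyMeasurable (Eventually.of_forall fun X => (hs.2 X).2.1)
  have hη2 := hη.hasDerivAt_integral_mul hh hη
  have hac := ha.hasDerivAt_integral_mul hh hc
  have hleft := ha.const.hasDerivAt_integral_mul hh hc
  have hright := ha.hasDerivAt_integral_mul hh hc.const
  -- Symmetry between the potentials at times `t` and `s`. Differentiating in `s` at `t` yields `∫ φ
  -- ∂ₜ(𝒢φ) = ∫ ∂ₜφ 𝒢φ` without treating `∂ₜΦ` as a potential.
  have hsymm : (fun s => ∫ X, Φ t (X, 0) * fderiv ℝ (Φ s) (X, 0) (0, 1))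
      =ᶠ[𝓝 t] fun s => ∫ X, Φ s (X, 0) * fderiv ℝ (Φ t) (X, 0) (0, 1) := by
    filter_upwards [hI.mem_nhds ht, hL2 ha, hL2 hc] with s hs has hcs
    have := (hΦ t ht).integral_mul_comm hb hpos (hΦ s hs)
    simp only [← (hΦ t ht).surface, ← (hΦ s hs).surface] at this
    exact this ((ha.memLp hh).integrable_mul hcs) (has.integrable_fun_mul (hc.memLp hh))
  have hrec := hleft.unique (hright.congr_of_eventuallyEq hsymm)
  simp only [deriv_const, zero_mul, mul_zero, integral_zero, zero_add, add_zero] at hrec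
  have iη := (hη.memLp hh).integrable_fun_mul (hη.memLp hh)
  have ia := (ha.memLp hh).integrable_fun_mul (hc.memLp hh)
  constructor
  · rw [show energyDensity g b (η t) (φ t) = _ from funext (hden t ht)]
    exact (iη.const_mul _).add (ia.const_mul _)
  have hE : (fun s => ∫ X, energyDensity g b (η s) (φ s) X) =ᶠ[𝓝 t] fun s =>
      1 / 2 * g * (∫ X, η s X * η s X)
        + 1 / 2 * ∫ X, Φ s (X, 0) * fderiv ℝ (Φ s) (X, 0) (0, 1) := by
    filter_upwards [hI.mem_nhds ht, hL2 hη, hL2 ha, hL2 hc] with s hs hηs has hcs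
    simp only [hden s hs]
    rw [integral_add ((hηs.integrable_fun_mul hηs).const_mul _) ((has.integrable_fun_mul hcs).const_mul _),
      integral_const_mul, integral_const_mul]
  refine (((hη2.const_mul (1 / 2 * g)).add (hac.const_mul (1 / 2))).congr_of_eventuallyEq
    hE).congr_deriv ?_
  rw [hrec]
  have i1 : Integrable fun X => η t X * deriv (fun s => η s X) t :=
    (hη.memLp hh).integrable_fun_mul (hη.memLp_deriv hh)
  rw [integral_add (by simpa only [mul_assoc] using i1.const_mul g)
    ((ha.memLp_deriv hh).integrable_fun_mul (hc.memLp hh))]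
  have hcomm : ∫ X, deriv (fun r => η r X) t * η t X = ∫ X, η t X * deriv (fun r => η r X) t := by
    simp only [mul_comm]
  simp only [mul_assoc, integral_const_mul, hcomm]
  ring

end Waves

/-! ### Transport by the surface current and the energy balance -/

/-- The energy transported by a bounded planar current. -/
theorem integral_mul_planeDiv_smul {f : Plane → ℝ} {V : Plane → Plane} (hf : ContDiff ℝ 1 f)
    (hf2 : MemLp f 2 volume) (hV : ContDiff ℝ 1 V) {k₀ k₁ : ℝ} (hk₀ : ∀ X, ‖V X‖ ≤ k₀)
    (hk₁ : ∀ X, ‖fderiv ℝ V X‖ ≤ k₁)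
    (hi : Integrable fun X => f X * planeDiv (fun Y => f Y • V Y) X) :
    (Integrable fun X => planeDiv V X * f X ^ 2) ∧
    ∫ X, f X * planeDiv (fun Y => f Y • V Y) X = 1 / 2 * ∫ X, planeDiv V X * f X ^ 2 := by
  have hsq : Integrable fun X => f X ^ 2 := hf2.integrable_sq
  have hVc := hV.continuous_fderiv one_ne_zero
  have hdc : Continuous (planeDiv V) := by
    unfold planeDiv
    fun_prop
  have hdiv : Integrable fun X => planeDiv V X * f X ^ 2 :=
    hsq.bdd_mul (c := 2 * k₁) hdc.aestronglyMeasurable (Eventually.of_forall fun X =>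
      (abs_planeDiv_le V X).trans (by linarith [hk₁ X]))
  refine ⟨hdiv, ?_⟩
  have hfd := fun X => hf.differentiable one_ne_zero X
  have hVd := fun X => hV.differentiable one_ne_zero X
  have hpt : ∀ X, planeDiv (fun Y => f Y ^ 2 • V Y) X
      = 2 * (f X * planeDiv (fun Y => f Y • V Y) X) - planeDiv V X * f X ^ 2 := by
    intro X
    have h2 := (hfd X).hasFDerivAt.pow 2
    have h3 : fderiv ℝ (fun Y => f Y ^ 2) X = _ := h2.fderiv
    rw [planeDiv_smul (f := fun Y => f Y ^ 2) ((hfd X).pow 2) (hVd X), planeDiv_smul (hfd X) (hVd X), h3]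
    simp
    ring
  have hzero := integral_planeDiv_eq_zero (G := fun Y => f Y ^ 2 • V Y) ((hf.pow 2).smul hV)
    (hsq.smul_bdd k₀ hV.continuous.aestronglyMeasurable (Eventually.of_forall hk₀))
    (by
      rw [show planeDiv (fun Y => f Y ^ 2 • V Y) = _ from funext hpt]
      exact (hi.const_mul 2).sub hdiv)
  simp only [hpt] at hzero
  rw [integral_sub (hi.const_mul 2) hdiv, integral_const_mul] at hzero
  linarith

theorem mainTheorem5 (K : ℕ → ℝ) (A M : ℝ) :
    ∃ C : ℝ, ∀ (δ ε g : ℝ) (I : Set ℝ) (b : Plane → ℝ)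
      (U : ℝ → Space → Space) (ζ : ℝ → Plane → ℝ)
      (η φ : ℝ → Plane → ℝ) (Φ : ℝ → Space → ℝ),
      0 < δ → δ < 1 → 0 < ε → 0 < g → IsOpen I →
      IsBathymetry b →
      IsBackground I b δ K A U ζ →
      IsWave I g b U η φ →
      (∀ t ∈ I, IsPotential b (φ t) (Φ t)) →
      IsSmoothDecaying I b η Φ →
      (∀ t ∈ I, ∫ X : Plane, spaceGrad (Φ t) (X, 0) ⬝ᵥ spaceGrad (Φ t) (X, 0) ≤ (M * ε) ^ 2) →
      ∀ t ∈ I,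
        Integrable (energyDensity g b (η t) (φ t)) ∧
        Integrable (fun X => planeDiv (surfaceCurrent U t) X * (1 / 2 * g * (η t X) ^ 2)) ∧
        IntegrableOn (production (U t) (spaceGrad (Φ t))) (fluidDomain 0 b) ∧
        Integrable (fun X =>
          (U t (X, 0)).2 * ((dirichletNeumann b (φ t) X) ^ 2 - ‖gradient (φ t) X‖ ^ 2)) ∧
        ∃ r : ℝ,
          HasDerivAt (fun s => ∫ X, energyDensity g b (η s) (φ s) X)
            (-(∫ X, planeDiv (surfaceCurrent U t) X * (1 / 2 * g * (η t X) ^ 2))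
              + (∫ p in fluidDomain 0 b, production (U t) (spaceGrad (Φ t)) p) + r) t ∧
          r = 1 / 2 * ∫ X, (U t (X, 0)).2
            * ((dirichletNeumann b (φ t) X) ^ 2 - ‖gradient (φ t) X‖ ^ 2) ∧
          |r| ≤ C * ε ^ 2 * δ := by
  -- The factor `½` comes from `r`, `A (1 + K 0 + K 1)` from the bound on the vertical current, and
  -- `M²` from the wave size.
  refine ⟨1 / 2 * (A * (1 + K 0 + K 1)) * M ^ 2, ?_⟩
  intro δ ε g I b U ζ η φ Φ hδ hδ1 _ _ hI hbath hU hW hΦ hS hM t ht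
  have hb : ContDiff ℝ 1 b := hbath.contDiff.of_le (by simp)
  have hpos : ∀ X, 0 < b X := by
    obtain ⟨bmin, bmax, R, h0, h1, -⟩ := hbath.exists_bounds
    exact fun X => h0.trans_le (h1 X).1
  have hP := hΦ t ht
  obtain ⟨h, hh, hη, ha, hc, hgrad⟩ := hS.exists_dominated hI hpos ht
  obtain ⟨hE, hE'⟩ := hasDerivAt_energy (g := g) hI hb hpos hΦ ht hh hη ha hc
  have hV : ContDiff ℝ 1 (U t) := (contDiff_slice hU.contDiff ht).of_le (by simp)
  have hbound : ∀ X z, -b X ≤ z → z ≤ 0 → ‖U t (X, z)‖ ≤ K 0 ∧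
      ‖fderiv ℝ (U t) (X, z)‖ ≤ K 1 * δ := by
    intro X z h1 h2
    have e0 := hU.slow t ht X z h1 (h2.trans (le_max_left _ _)) 0
    have e1 := hU.slow t ht X z h1 (h2.trans (le_max_left _ _)) 1
    rw [norm_iteratedFDeriv_zero] at e0
    rw [norm_iteratedFDeriv_one] at e1
    exact ⟨by simpa using e0, by simpa using e1⟩
  have hDN : ∀ X, dirichletNeumann b (φ t) X = fderiv ℝ (Φ t) (X, 0) (0, 1) :=
    hP.dirichletNeumann_eq hb hpos
  set W : Plane → ℝ := fun X => (U t (X, 0)).2 with hWdef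
  set c : Plane → ℝ := fun X => fderiv ℝ (Φ t) (X, 0) (0, 1)
  have hWc : Continuous W := by
    have := hV.continuous
    fun_prop
  have hWle : ∀ X, |W X| ≤ A * (1 + K 0 + K 1) * δ := hU.abs_vertical_le hδ hδ1 hpos ht
  have hg2 : ∀ i, MemLp (fun X => spaceGrad (Φ t) (X, 0) i) 2 volume := fun i =>
    hh.mono' (((contDiff_spaceGrad hP.contDiff i).continuous.comp
      (Continuous.prodMk_left 0)).aestronglyMeasurable) (Eventually.of_forall fun X =>
      ((fderiv ℝ (Φ t) (X, 0)).unit_le_opNorm _ (norm_coordDir_le i)).trans (hgrad X))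
  have hu2 : Integrable fun X => spaceGrad (Φ t) (X, 0) ⬝ᵥ spaceGrad (Φ t) (X, 0) :=
    integrable_finsetSum _ fun i _ => (hg2 i).integrable_fun_mul (hg2 i)
  have hc2 : Integrable fun X => c X ^ 2 := (hg2 2).integrable_sq
  have hdiff : ∀ X, c X ^ 2 - ‖gradient (φ t) X‖ ^ 2
      = 2 * c X ^ 2 - spaceGrad (Φ t) (X, 0) ⬝ᵥ spaceGrad (Φ t) (X, 0) := by
    intro X
    rw [hP.spaceGrad_sq]
    ring
  have hR : Integrable fun X => W X * (c X ^ 2 - ‖gradient (φ t) X‖ ^ 2) := by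
    simp only [hdiff]
    exact ((hc2.const_mul 2).sub hu2).bdd_mul hWc.aestronglyMeasurable (Eventually.of_forall hWle)
  have hD : ContDiff ℝ 1 (surfaceCurrent U t) :=
    contDiff_fst.comp (hV.comp (contDiff_prodMk_left (0 : ℝ)))
  have hD0 : ∀ X, ‖surfaceCurrent U t X‖ ≤ K 0 := fun X =>
    (norm_fst_le _).trans (hbound X 0 (by linarith [hpos X]) le_rfl).1
  have hD1 : ∀ X, ‖fderiv ℝ (surfaceCurrent U t) X‖ ≤ K 1 * δ := by
    intro X
    refine le_trans ?_ (hbound X 0 (by linarith [hpos X]) le_rfl).2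
    have e := (HasFDerivAt.comp (f := fun Y : Plane => (Y, (0 : ℝ))) X
      (hV.differentiable one_ne_zero (X, 0)).hasFDerivAt (hasFDerivAt_prodMk_left X 0)).fst
    have e' : fderiv ℝ (surfaceCurrent U t) X = _ := e.fderiv
    rw [e']
    refine ContinuousLinearMap.opNorm_le_bound _ (norm_nonneg _) fun v => ?_
    refine (norm_fst_le _).trans (((fderiv ℝ (U t) (X, 0)).le_opNorm (v, 0)).trans (le_of_eq ?_))
    rw [Prod.norm_def (v, 0), norm_zero, max_eq_left (norm_nonneg v)]
  have hηdiv : ∀ X, planeDiv (fun Y => η t Y • surfaceCurrent U t Y) X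
      = c X - deriv (fun s => η s X) t := by
    intro X
    have := hW.elevation_eq t ht X
    rw [hDN] at this
    exact eq_sub_of_add_eq' this
  have hηL := hη.memLp hh
  have hcL : MemLp c 2 volume := hc.memLp hh
  -- Integrability is read off the elevation equation, which expresses the divergence as a
  -- difference of two square integrable functions; `hi₂` uses the potential equation likewise.
  have hi₁ : Integrable fun X => η t X * planeDiv (fun Y => η t Y • surfaceCurrent U t Y) X := by
    simp only [hηdiv]
    exact hηL.integrable_fun_mul (hcL.sub (hη.memLp_deriv hh))
  obtain ⟨hT, hT'⟩ := integral_mul_planeDiv_smul (contDiff_slice hS.contDiff_elevation ht) hηL hD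
    hD0 hD1 hi₁
  have hadv : ∀ X, fderiv ℝ (φ t) X (surfaceCurrent U t X)
      = -g * η t X - deriv (fun s => Φ s (X, 0)) t := by
    intro X
    have h1 : (fun s => φ s X) =ᶠ[𝓝 t] fun s => Φ s (X, 0) := by
      filter_upwards [hI.mem_nhds ht] with s hs using ((hΦ s hs).surface X).symm
    rw [← h1.deriv_eq]
    exact eq_sub_of_add_eq' (hW.potential_eq t ht X)
  have hi₂ : Integrable fun X => fderiv ℝ (φ t) X (surfaceCurrent U t X) * c X := by
    simp only [hadv]
    exact ((hηL.const_mul (-g)).sub (ha.memLp_deriv hh)).integrable_fun_mul hcL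
  -- Splitting the current into `Ū` and `W̄₀` yields `W̄₀ (𝒢φ)²` from `V·∇Φ`, half of which is
  -- removed by `-½|∇Φ|² W̄₀`; this is the origin of the remainder.
  have hflux : ∀ X, fderiv ℝ (Φ t) (X, 0) (U t (X, 0)) * fderiv ℝ (Φ t) (X, 0) (0, 1)
      - 1 / 2 * (spaceGrad (Φ t) (X, 0) ⬝ᵥ spaceGrad (Φ t) (X, 0)) * (U t (X, 0)).2
      = fderiv ℝ (φ t) X (surfaceCurrent U t X) * c X
        + 1 / 2 * (W X * (c X ^ 2 - ‖gradient (φ t) X‖ ^ 2)) := by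
    intro X
    have h1 : U t (X, 0) = (surfaceCurrent U t X, 0) + W X • ((0, 1) : Space) := by
      ext <;> simp [surfaceCurrent, hWdef]
    have h2 : fderiv ℝ (Φ t) (X, 0) (U t (X, 0))
        = fderiv ℝ (φ t) X (surfaceCurrent U t X) + W X * c X := by
      rw [h1, map_add, map_smul, ← hP.fderiv_trace]
      rfl
    rw [h2, hP.spaceGrad_sq]
    ring
  obtain ⟨hProd, hProd'⟩ := integral_production hb hpos hP hV
    (fun p hp => hU.incompressible t ht p.1 p.2 hp.1.le (le_max_of_le_left hp.2.le))
    (hU.impermeable t ht) (fun p hp => (hbound p.1 p.2 hp.1.le hp.2.le).1)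
    (fun p hp => (hbound p.1 p.2 hp.1.le hp.2.le).2)
    (by
      simp only [hflux]
      exact hi₂.add (hR.const_mul (1 / 2)))
  simp only [hflux] at hProd'
  rw [integral_add hi₂ (hR.const_mul (1 / 2)), integral_const_mul] at hProd'
  have hcomm : ∀ X, planeDiv (surfaceCurrent U t) X * (1 / 2 * g * η t X ^ 2)
      = 1 / 2 * g * (planeDiv (surfaceCurrent U t) X * η t X ^ 2) := fun X => by ring
  simp only [hDN, hcomm]
  refine ⟨hE, hT.const_mul _, hProd, hR, _, hE'.congr_deriv ?_, rfl, ?_⟩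
  -- The terms `gη 𝒢φ` of opposite sign cancel here, leaving only the two advection terms.
  · have hpt : ∀ X, g * η t X * deriv (fun s => η s X) t
        + deriv (fun s => Φ s (X, 0)) t * fderiv ℝ (Φ t) (X, 0) (0, 1)
        = -g * (η t X * planeDiv (fun Y => η t Y • surfaceCurrent U t Y) X)
          - fderiv ℝ (φ t) X (surfaceCurrent U t X) * c X := by
      intro X
      rw [hηdiv, hadv]
      ring
    simp only [hpt]
    rw [integral_sub (hi₁.const_mul (-g)) hi₂, integral_const_mul,
      integral_const_mul, hT', hProd']
    ring
  · have hB : 0 ≤ A * (1 + K 0 + K 1) * δ := (abs_nonneg _).trans (hWle 0)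
    have h1 : |∫ X, W X * (c X ^ 2 - ‖gradient (φ t) X‖ ^ 2)|
        ≤ A * (1 + K 0 + K 1) * δ * (M * ε) ^ 2 := by
      refine le_trans ?_ (mul_le_mul_of_nonneg_left (hM t ht) hB)
      rw [← integral_const_mul, ← Real.norm_eq_abs]
      refine norm_integral_le_of_norm_le (hu2.const_mul _) (Eventually.of_forall fun X => ?_)
      rw [norm_mul]
      refine mul_le_mul (hWle X) ?_ (norm_nonneg _) hB
      rw [hP.spaceGrad_sq, Real.norm_eq_abs, abs_le]
      constructor <;> linarith [sq_nonneg (c X), sq_nonneg ‖gradient (φ t) X‖]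
    rw [abs_mul, abs_of_pos (by norm_num : (0 : ℝ) < 1 / 2)]
    calc _ ≤ 1 / 2 * (A * (1 + K 0 + K 1) * δ * (M * ε) ^ 2) := by gcongr
      _ = _ := by ring
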